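/- **Setting.** Let $N_x\ge 1$, let $m_0,m_1,m_2\ge 1$ be coarsening factors, let $N_3\ge 2$, and let $N_\ell=m_\ell(N_{\ell+1}-1)+1$ for $\ell=2,1,0$ be the numbers of time points on the levels. Let $\Phi_0,\dots,\Phi_3$ be $N_x\times N_x$ matrices (real or complex). On level $\ell$ with time points $0,\dots,N_\ell-1$, the C-points are the multiples of $m_\ell$ and all other points are F-points. Define block matrices with $N_x\times N_x$ blocks: * $A_\ell$ has diagonal blocks $I$, first subdiagonal blocks $-\Phi_\ell$, and zero blocks elsewhere; * $P_\ell$ has block $(p,c)$ equal to $\Phi_\ell^{\,p-cm_\ell}$ if $cm_\ell\le p<(c+1)m_\ell$, else $0$; * $R_\ell$ has block $(c,p)$ equal to $\Phi_\ell^{\,cm_\ell-p}$ if $(c-1)m_\ell<p\le cm_\ell$, else $0$; * $R_{I_\ell}$ has block $(c,p)$ equal to $I$ if $p=cm_\ell$, else $0$; * $S_\ell$ embeds the F-points into all points, and $Q_\ell=S_\ell(S_\ell^TA_\ell S_\ell)^{-1}S_\ell^T$. The four-level MGRIT V-cycle with F-relaxation for $A_0u=g$ is the following recursion. On level $\ell<3$,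 for $A_\ell x=b$, replace $x$ by $y=x+Q_\ell(b-A_\ell x)$, compute $z$ by the V-cycle on level $\ell+1$ with right-hand side $R_\ell(b-A_\ell y)$ and zero initial guess, and return $y+P_\ell z$; on level $3$ solve exactly. Let $u_0,u_1,\dots$ be the iterates from an initial guess $u_0$ and $r_i=g-A_0u_i$. The worst-case convergence factor $c_f$ is the supremum of $\|r_{i+1}\|_2/\|r_i\|_2$ (with $0/0=0$) over all $g$, all $u_0$ and all $i\ge 0$, where $i=0$ is included only for those $u_0$ whose residual $r_0$ vanishes at the F-points of level $0$ (as after F-relaxation of the initial guess). The error propagator is $$\mathcal E_F^{4}=P_0R_{I_0}-\big(P_0P_1P_2A_3^{-1}R_2R_1R_0+P_0Q_1R_0+P_0P_1Q_2R_1R_0\big)A_0P_0R_{I_0},$$ and $\mathcal E_F^{4,\Delta}=R_{I_0}\mathcal E_F^{4}P_0$ is the propagator on level $1$. **Theorem.** Suppose that $\Phi_\ell=X\,\mathrm{diag}(\lambda_{\ell,1},\dots,\lambda_{\ell,N_x})X^*$, $\ell=0,\dots,3$, with one unitary $X$, and $|\lambda_{\ell,k}|<1$ for all $\ell,k$. Let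 $\|\mathcal E_F^{4,\Delta}\|_1$ and $\|\mathcal E_F^{4,\Delta}\|_\infty$ denote the maximal absolute column sum and row sum of $\mathcal E_F^{4,\Delta}$ written in the common eigenbasis, i.e. with each $\Phi_\ell$ replaced by $\mathrm{diag}(\lambda_{\ell,1},\dots,\lambda_{\ell,N_x})$. Then $$c_f\le\sqrt{\|\mathcal E_F^{4,\Delta}\|_1\,\|\mathcal E_F^{4,\Delta}\|_\infty},$$ $$\|\mathcal E_F^{4,\Delta}\|_1=\max_{1\le k\le N_x,\;0\le d\le m_1m_2-1}s^{\rm col}_d(k),\qquad \|\mathcal E_F^{4,\Delta}\|_\infty=\max_{1\le k\le N_x,\;1\le t\le m_1m_2}s^{\rm row}_{N_1-1-m_1m_2+t}(k),$$ where $s^{\rm col}_d(k)$ and $s^{\rm row}_p(k)$, the absolute sums of the column and row of $\mathcal E_F^{4,\Delta}$ (in the eigenbasis) belonging to mode $k$ and time point $d$ resp. $p$ of level $1$, are given as follows. Fix $k$ and write $\lambda_\ell=\lambda_{\ell,k}$, $a=|\lambda_1|$, $b=|\lambda_2|$, $c=|\lambda_3|$, $g_n(x)=\frac{1-x^n}{1-x}=\sum_{q=0}^{n-1}x^q$,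 $w_1=|\lambda_1-\lambda_0^{m_0}|$, $w_2=|\lambda_2-\lambda_0^{m_0}\lambda_1^{m_1-1}|$, $w_3=|\lambda_3-\lambda_0^{m_0}\lambda_1^{m_1-1}\lambda_2^{m_2-1}|$, and $G=c^{N_3-2}+g_{N_3-2}(c)\,g_{m_2}(b)\,g_{m_1}(a)$. Columns: * $s^{\rm col}_0=w_3G+w_2\,g_{m_2-1}(b)\,g_{m_1}(a)+w_1\,g_{m_1-1}(a)$; * $s^{\rm col}_{m_1(m_2-j)}=w_2\,g_{j-1}(b)\,g_{m_1}(a)+w_1\,g_{m_1-1}(a)+b^{j-1}w_2\,G$ for $1\le j\le m_2-1$; * $s^{\rm col}_{m_1(m_2-j)-r-1}=w_1\big[a^r g_{m_1}(a)\,g_j(b)+g_r(a)\big]+b^ja^rw_1\,G$ for $0\le j\le m_2-1$, $0\le r\le m_1-2$. Rows, with $H=w_1\,g_{m_2}(b)\,g_{m_1-1}(a)+w_2\,g_{m_2-1}(b)+w_3$: * $s^{\rm row}_{N_1-1}=g_{N_3-1}(c)\,H$; * $s^{\rm row}_{N_1-1-m_1m_2+jm_1}=g_j(b)\big[w_1\,g_{m_1-1}(a)+w_2\big]+b^jg_{N_3-2}(c)\,H$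 for $1\le j\le m_2-1$; * $s^{\rm row}_{N_1-1-m_1m_2+r+jm_1}=a^rb^jg_{N_3-2}(c)\,H+a^rg_j(b)\big[w_2+w_1\,g_{m_1-1}(a)\big]+w_1\,g_r(a)$ for $0\le j\le m_2-1$, $1\le r\le m_1-1$. -/

import Mathlib

open scoped Matrix ENNReal

noncomputable section

namespace MGRIT

/-- Time-stepping operators and other operators on the spatial unknowns. -/
abbrev SpaceOp (Nx : ℕ) : Type := Matrix (Fin Nx) (Fin Nx) ℂ

/-- Space-time vectors with `n` time points and `Nx` spatial unknowns. -/
abbrev STVec (n Nx : ℕ) : Type := Fin n × Fin Nx → ℂ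

/-- Space-time matrices from `n'` to `n` time points. -/
abbrev STMat (n n' Nx : ℕ) : Type := Matrix (Fin n × Fin Nx) (Fin n' × Fin Nx) ℂ

/-- The F-points of a grid with `n` time points and coarsening factor `m`;
the C-points are the time points whose index is a multiple of `m`. -/
abbrev FPoint (n m : ℕ) : Type := {p : Fin n // ¬ m ∣ p.val}

/-- The block bidiagonal matrix `A` with identity blocks on the diagonal and
`-Φ` on the first block subdiagonal. -/
def systemMatrix {Nx : ℕ} (n : ℕ) (Φ : SpaceOp Nx) : STMat n n Nx :=
  Matrix.of fun p q =>
    if p.1.val = q.1.val then (1 : SpaceOp Nx) p.2 q.2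
    else if p.1.val = q.1.val + 1 then -(Φ p.2 q.2)
    else 0

/-- Ideal interpolation `P`: the block in row `p`, column `c` is `Φ ^ (p - c m)` for
`c m ≤ p < c m + m`, and zero otherwise. -/
def interpolation {Nx : ℕ} (n n' m : ℕ) (Φ : SpaceOp Nx) : STMat n n' Nx :=
  Matrix.of fun p c =>
    if c.1.val * m ≤ p.1.val ∧ p.1.val < c.1.val * m + m then
      (Φ ^ (p.1.val - c.1.val * m)) p.2 c.2
    else 0

/-- Ideal restriction `R`: the block in row `c`, column `p` is `Φ ^ (c m - p)` for
`c m - m < p ≤ c m`, and zero otherwise. -/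
def restriction {Nx : ℕ} (n n' m : ℕ) (Φ : SpaceOp Nx) : STMat n' n Nx :=
  Matrix.of fun c p =>
    if p.1.val ≤ c.1.val * m ∧ c.1.val * m < p.1.val + m then
      (Φ ^ (c.1.val * m - p.1.val)) c.2 p.2
    else 0

/-- Restriction by injection `R_I`, which picks out the C-points. -/
def injection (Nx n n' m : ℕ) : STMat n' n Nx :=
  Matrix.of fun c p =>
    if p.1.val = c.1.val * m then (1 : SpaceOp Nx) c.2 p.2 else 0

/-- The operator `S`, which embeds the F-points into all time points. -/
def fEmbedding (Nx n m : ℕ) : Matrix (Fin n × Fin Nx) (FPoint n m × Fin Nx) ℂ :=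
  Matrix.of fun p q => if p.1 = q.1.val then (1 : SpaceOp Nx) p.2 q.2 else 0

/-- `S (Sᵀ A S)⁻¹ Sᵀ`. -/
def fSolve {Nx : ℕ} (n m : ℕ) (Φ : SpaceOp Nx) : STMat n n Nx :=
  fEmbedding Nx n m *
    ((fEmbedding Nx n m)ᵀ * systemMatrix n Φ * fEmbedding Nx n m)⁻¹ *
    (fEmbedding Nx n m)ᵀ

/-! In what follows `m ℓ` is the coarsening factor from level `ℓ` to level `ℓ + 1`, `N ℓ` is the
number of time points on level `ℓ`, and `Φ ℓ` is the time-stepping operator on level `ℓ`. -/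

/-- The system matrix on level `ℓ`. -/
def Amat {Nx : ℕ} (N : ℕ → ℕ) (Φ : ℕ → SpaceOp Nx) (ℓ : ℕ) : STMat (N ℓ) (N ℓ) Nx :=
  systemMatrix (N ℓ) (Φ ℓ)

/-- Ideal interpolation from level `ℓ + 1` to level `ℓ`. -/
def Pmat {Nx : ℕ} (m N : ℕ → ℕ) (Φ : ℕ → SpaceOp Nx) (ℓ : ℕ) : STMat (N ℓ) (N (ℓ + 1)) Nx :=
  interpolation (N ℓ) (N (ℓ + 1)) (m ℓ) (Φ ℓ)

/-- Ideal restriction from level `ℓ` to level `ℓ + 1`. -/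
def Rmat {Nx : ℕ} (m N : ℕ → ℕ) (Φ : ℕ → SpaceOp Nx) (ℓ : ℕ) : STMat (N (ℓ + 1)) (N ℓ) Nx :=
  restriction (N ℓ) (N (ℓ + 1)) (m ℓ) (Φ ℓ)

/-- Restriction by injection from level `ℓ` to level `ℓ + 1`. -/
def RImat (Nx : ℕ) (m N : ℕ → ℕ) (ℓ : ℕ) : STMat (N (ℓ + 1)) (N ℓ) Nx :=
  injection Nx (N ℓ) (N (ℓ + 1)) (m ℓ)

/-- `S_ℓ (S_ℓᵀ A_ℓ S_ℓ)⁻¹ S_ℓᵀ`. -/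
def Fmat {Nx : ℕ} (m N : ℕ → ℕ) (Φ : ℕ → SpaceOp Nx) (ℓ : ℕ) : STMat (N ℓ) (N ℓ) Nx :=
  fSolve (N ℓ) (m ℓ) (Φ ℓ)

/-- F-relaxation on level `ℓ` for the system `A_ℓ x = b`. -/
def fRelax {Nx : ℕ} (m N : ℕ → ℕ) (Φ : ℕ → SpaceOp Nx) (ℓ : ℕ) (b x : STVec (N ℓ) Nx) :
    STVec (N ℓ) Nx :=
  x + Fmat m N Φ ℓ *ᵥ (b - Amat N Φ ℓ *ᵥ x)

/-- One MGRIT V-cycle with F-relaxation on level `ℓ`, with `c` coarser levels below it, applied to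
`A_ℓ x = b` with initial guess `x`: relax, restrict the residual, compute the correction by a
V-cycle with zero initial guess on the next level, interpolate the correction. The coarsest level
is solved exactly. -/
def vCycle {Nx : ℕ} (m N : ℕ → ℕ) (Φ : ℕ → SpaceOp Nx) :
    ℕ → (ℓ : ℕ) → STVec (N ℓ) Nx → STVec (N ℓ) Nx → STVec (N ℓ) Nx
  | 0, ℓ, b, _ => (Amat N Φ ℓ)⁻¹ *ᵥ b
  | c + 1, ℓ, b, x =>
      fRelax m N Φ ℓ b x +
        Pmat m N Φ ℓ *ᵥ
          vCycle m N Φ c (ℓ + 1)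
            (Rmat m N Φ ℓ *ᵥ (b - Amat N Φ ℓ *ᵥ fRelax m N Φ ℓ b x)) 0

/-- The iterates of four-level MGRIT V-cycles with F-relaxation for `A_0 u = g`. -/
def iterate {Nx : ℕ} (m N : ℕ → ℕ) (Φ : ℕ → SpaceOp Nx) (g u₀ : STVec (N 0) Nx) (i : ℕ) :
    STVec (N 0) Nx :=
  (fun u => vCycle m N Φ 3 0 g u)^[i] u₀

/-- The fine-grid residual of the `i`-th iterate. -/
def residual {Nx : ℕ} (m N : ℕ → ℕ) (Φ : ℕ → SpaceOp Nx) (g u₀ : STVec (N 0) Nx) (i : ℕ) :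
    STVec (N 0) Nx :=
  g - Amat N Φ 0 *ᵥ iterate m N Φ g u₀ i

/-- The Euclidean norm of a space-time vector. -/
def norm2 {n Nx : ℕ} (v : STVec n Nx) : ℝ := √(∑ p, ‖v p‖ ^ 2)

/-- The initial residual vanishes at all F-points of the fine grid, as it does for an initial guess
to which F-relaxation has been applied. -/
def FRelaxedStart {Nx : ℕ} (m N : ℕ → ℕ) (Φ : ℕ → SpaceOp Nx) (g u₀ : STVec (N 0) Nx) : Prop :=
  ∀ (p : FPoint (N 0) (m 0)) (a : Fin Nx), residual m N Φ g u₀ 0 (p.val, a) = 0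

/-- The worst-case convergence factor of four-level MGRIT V-cycles with F-relaxation: the supremum
of `‖r_{i+1}‖₂ / ‖r_i‖₂` over all right-hand sides, initial guesses and iterations, where the very
first iteration counts only if the initial residual vanishes at the F-points. The quotient is taken
in `[0, ∞]`, where `0 / 0 = 0` and `x / 0 = ∞` for `x > 0`. -/
def convergenceFactor {Nx : ℕ} (m N : ℕ → ℕ) (Φ : ℕ → SpaceOp Nx) : ℝ≥0∞ :=
  ⨆ (g : STVec (N 0) Nx) (u₀ : STVec (N 0) Nx) (i : ℕ)
    (_ : 1 ≤ i ∨ FRelaxedStart m N Φ g u₀),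
    ENNReal.ofReal (norm2 (residual m N Φ g u₀ (i + 1))) /
      ENNReal.ofReal (norm2 (residual m N Φ g u₀ i))

/-- The error propagator of four-level MGRIT V-cycles with F-relaxation on level `0`. -/
def errorPropagator {Nx : ℕ} (m N : ℕ → ℕ) (Φ : ℕ → SpaceOp Nx) : STMat (N 0) (N 0) Nx :=
  Pmat m N Φ 0 * RImat Nx m N 0
    - (Pmat m N Φ 0 * Pmat m N Φ 1 * Pmat m N Φ 2) * (Amat N Φ 3)⁻¹ *
        (Rmat m N Φ 2 * Rmat m N Φ 1 * Rmat m N Φ 0) *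
        Amat N Φ 0 * Pmat m N Φ 0 * RImat Nx m N 0
    - (Pmat m N Φ 0 * Fmat m N Φ 1 * Rmat m N Φ 0 *
          Amat N Φ 0 * Pmat m N Φ 0 * RImat Nx m N 0
        + (Pmat m N Φ 0 * Pmat m N Φ 1) * Fmat m N Φ 2 * (Rmat m N Φ 1 * Rmat m N Φ 0) *
          Amat N Φ 0 * Pmat m N Φ 0 * RImat Nx m N 0)

/-- The error propagator on level `1`, that is, on the C-points of level `0`. -/
def coarseErrorPropagator {Nx : ℕ} (m N : ℕ → ℕ) (Φ : ℕ → SpaceOp Nx) : STMat (N 1) (N 1) Nx :=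
  RImat Nx m N 0 * errorPropagator m N Φ * Pmat m N Φ 0

/-- The level-`1` error propagator in the common eigenbasis: the time-stepping operators are replaced
by the diagonal matrices of their eigenvalues. -/
def diagonalizedPropagator {Nx : ℕ} (m N : ℕ → ℕ) (lam : ℕ → Fin Nx → ℂ) :
    STMat (N 1) (N 1) Nx :=
  coarseErrorPropagator m N fun ℓ => Matrix.diagonal (lam ℓ)

/-- Absolute column sum. -/
def absColSum {ι κ : Type*} [Fintype ι] (M : Matrix ι κ ℂ) (q : κ) : ℝ := ∑ p, ‖M p q‖

/-- Absolute row sum. -/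
def absRowSum {ι κ : Type*} [Fintype κ] (M : Matrix ι κ ℂ) (p : ι) : ℝ := ∑ q, ‖M p q‖

/-- The matrix norm `‖M‖₁` (maximal absolute column sum). -/
def matNorm1 {ι κ : Type*} [Fintype ι] (M : Matrix ι κ ℂ) : ℝ := ⨆ q, absColSum M q

/-- The matrix norm `‖M‖_∞` (maximal absolute row sum). -/
def matNormInf {ι κ : Type*} [Fintype κ] (M : Matrix ι κ ℂ) : ℝ := ⨆ p, absRowSum M p

/-! The explicit column and row sums for one spatial mode. The numbers `l0 l1 l2 l3` are the
eigenvalues of this mode on the levels `0, 1, 2, 3`, the numbers `m0 m1 m2` are the coarsening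
factors, and `N3` is the number of time points on the coarsest level. -/

/-- `(1 - a ^ n) / (1 - a)`. -/
def geo (a : ℝ) (n : ℕ) : ℝ := (1 - a ^ n) / (1 - a)

/-- `|λ₁ - λ₀^{m₀}|`. -/
def w1 (m0 : ℕ) (l0 l1 : ℂ) : ℝ := ‖l1 - l0 ^ m0‖

/-- `|λ₂ - λ₀^{m₀} λ₁^{m₁-1}|`. -/
def w2 (m0 m1 : ℕ) (l0 l1 l2 : ℂ) : ℝ := ‖l2 - l0 ^ m0 * l1 ^ (m1 - 1)‖

/-- `|λ₃ - λ₀^{m₀} λ₁^{m₁-1} λ₂^{m₂-1}|`. -/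
def w3 (m0 m1 m2 : ℕ) (l0 l1 l2 l3 : ℂ) : ℝ :=
  ‖l3 - l0 ^ m0 * l1 ^ (m1 - 1) * l2 ^ (m2 - 1)‖

/-- Column sum for the first C-point on level `1`, that is, for the column `0`. -/
def colFirst (m0 m1 m2 N3 : ℕ) (l0 l1 l2 l3 : ℂ) : ℝ :=
  ‖l3‖ ^ (N3 - 2) * w3 m0 m1 m2 l0 l1 l2 l3
    + w3 m0 m1 m2 l0 l1 l2 l3 * geo ‖l3‖ (N3 - 2) * geo ‖l2‖ m2 * geo ‖l1‖ m1
    + w2 m0 m1 l0 l1 l2 * geo ‖l2‖ (m2 - 1) * geo ‖l1‖ m1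
    + w1 m0 l0 l1 * geo ‖l1‖ (m1 - 1)

/-- Column sum for the interior C-points of the first CF-interval: column `m₁ (m₂ - j)`,
for `j = 1, …, m₂ - 1`. -/
def colC (m0 m1 m2 N3 : ℕ) (l0 l1 l2 l3 : ℂ) (j : ℕ) : ℝ :=
  w2 m0 m1 l0 l1 l2 * (∑ p ∈ Finset.range (j - 1), ‖l2‖ ^ p) * geo ‖l1‖ m1
    + w1 m0 l0 l1 * geo ‖l1‖ (m1 - 1)
    + ‖l2‖ ^ (j - 1) * w2 m0 m1 l0 l1 l2 *
        (‖l3‖ ^ (N3 - 2) + geo ‖l3‖ (N3 - 2) * geo ‖l2‖ m2 * geo ‖l1‖ m1)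

/-- Column sum for the F-points of the first CF-interval: column `m₁ (m₂ - j) - r - 1`,
for `j = 0, …, m₂ - 1` and `r = 0, …, m₁ - 2`. -/
def colF (m0 m1 m2 N3 : ℕ) (l0 l1 l2 l3 : ℂ) (j r : ℕ) : ℝ :=
  w1 m0 l0 l1 *
      (‖l1‖ ^ r * (∑ q ∈ Finset.range m1, ‖l1‖ ^ q) * (∑ p ∈ Finset.range j, ‖l2‖ ^ p)
        + ∑ q ∈ Finset.range r, ‖l1‖ ^ q)
    + ‖l2‖ ^ j * ‖l1‖ ^ r * w1 m0 l0 l1 *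
        (‖l3‖ ^ (N3 - 2) + geo ‖l3‖ (N3 - 2) * geo ‖l2‖ m2 * geo ‖l1‖ m1)

/-- Row sum for the last C-point on level `1`, that is, for the row `N₁ - 1`. -/
def rowLast (m0 m1 m2 N3 : ℕ) (l0 l1 l2 l3 : ℂ) : ℝ :=
  geo ‖l3‖ (N3 - 1) *
    (w1 m0 l0 l1 * geo ‖l2‖ m2 * geo ‖l1‖ (m1 - 1)
      + w2 m0 m1 l0 l1 l2 * geo ‖l2‖ (m2 - 1)
      + w3 m0 m1 m2 l0 l1 l2 l3)

/-- Row sum for the interior C-points of the last FC-interval: row `N₁ - 1 - m₁ m₂ + j m₁`,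
for `j = 1, …, m₂ - 1`. -/
def rowC (m0 m1 m2 N3 : ℕ) (l0 l1 l2 l3 : ℂ) (j : ℕ) : ℝ :=
  geo ‖l2‖ j * (w1 m0 l0 l1 * geo ‖l1‖ (m1 - 1) + w2 m0 m1 l0 l1 l2)
    + ‖l2‖ ^ j * geo ‖l3‖ (N3 - 2) *
        (w1 m0 l0 l1 * geo ‖l2‖ m2 * geo ‖l1‖ (m1 - 1)
          + w2 m0 m1 l0 l1 l2 * geo ‖l2‖ (m2 - 1)
          + w3 m0 m1 m2 l0 l1 l2 l3)

/-- Row sum for the F-points of the last FC-interval: row `N₁ - 1 - m₁ m₂ + r + j m₁`,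
for `j = 0, …, m₂ - 1` and `r = 1, …, m₁ - 1`. -/
def rowF (m0 m1 m2 N3 : ℕ) (l0 l1 l2 l3 : ℂ) (j r : ℕ) : ℝ :=
  ‖l1‖ ^ r * ‖l2‖ ^ j * geo ‖l3‖ (N3 - 2) *
      (w2 m0 m1 l0 l1 l2 * geo ‖l2‖ (m2 - 1) + w3 m0 m1 m2 l0 l1 l2 l3)
    + ‖l1‖ ^ r * (∑ q ∈ Finset.range j, ‖l2‖ ^ q) *
        (w2 m0 m1 l0 l1 l2 + w1 m0 l0 l1 * geo ‖l1‖ (m1 - 1))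
    + ‖l1‖ ^ r * ‖l2‖ ^ j * w1 m0 l0 l1 * geo ‖l3‖ (N3 - 2) * geo ‖l2‖ m2 * geo ‖l1‖ (m1 - 1)
    + w1 m0 l0 l1 * geo ‖l1‖ r

/-- The explicit sum for column `d`, `0 ≤ d < m₁ m₂`. -/
def sCol (m0 m1 m2 N3 : ℕ) (l0 l1 l2 l3 : ℂ) (d : ℕ) : ℝ :=
  if d = 0 then colFirst m0 m1 m2 N3 l0 l1 l2 l3
  else if m1 ∣ d then colC m0 m1 m2 N3 l0 l1 l2 l3 (m2 - d / m1)
  else colF m0 m1 m2 N3 l0 l1 l2 l3 (m2 - 1 - d / m1) (m1 - 1 - d % m1)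

/-- The explicit sum for row `N₁ - 1 - m₁ m₂ + t`, `1 ≤ t ≤ m₁ m₂`. -/
def sRow (m0 m1 m2 N3 : ℕ) (l0 l1 l2 l3 : ℂ) (t : ℕ) : ℝ :=
  if t = m1 * m2 then rowLast m0 m1 m2 N3 l0 l1 l2 l3
  else if m1 ∣ t then rowC m0 m1 m2 N3 l0 l1 l2 l3 (t / m1)
  else rowF m0 m1 m2 N3 l0 l1 l2 l3 (t / m1) (t % m1)

/-! The indices in `sCol` and `sRow` enumerate the cases as described. -/

theorem sCol_zero (m0 m1 m2 N3 : ℕ) (l0 l1 l2 l3 : ℂ) :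
    sCol m0 m1 m2 N3 l0 l1 l2 l3 0 = colFirst m0 m1 m2 N3 l0 l1 l2 l3 := by
  simp [sCol]

theorem sCol_C (m0 m1 m2 N3 : ℕ) (l0 l1 l2 l3 : ℂ) (hm1 : 1 ≤ m1) (j : ℕ)
    (hj : 1 ≤ j) (hj' : j ≤ m2 - 1) :
    sCol m0 m1 m2 N3 l0 l1 l2 l3 (m1 * (m2 - j)) = colC m0 m1 m2 N3 l0 l1 l2 l3 j := by
  have h0 : m1 * (m2 - j) ≠ 0 := Nat.mul_ne_zero (by omega) (by omega)
  have h1 : m1 * (m2 - j) / m1 = m2 - j := Nat.mul_div_cancel_left _ hm1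
  have h2 : m2 - (m2 - j) = j := by omega
  rw [sCol, if_neg h0, if_pos (Dvd.intro _ rfl), h1, h2]

theorem sCol_F (m0 m1 m2 N3 : ℕ) (l0 l1 l2 l3 : ℂ) (j r : ℕ)
    (hj : j < m2) (hr : r + 2 ≤ m1) :
    sCol m0 m1 m2 N3 l0 l1 l2 l3 (m1 * (m2 - j) - r - 1)
      = colF m0 m1 m2 N3 l0 l1 l2 l3 j r := by
  obtain ⟨e, rfl⟩ : ∃ e, m2 = e + 1 + j := ⟨m2 - 1 - j, by omega⟩
  have h : m1 * (e + 1 + j - j) - r - 1 = (m1 - 1 - r) + m1 * e := by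
    have : m1 * (e + 1 + j - j) = m1 * e + m1 := by
      rw [Nat.add_sub_cancel, Nat.mul_add, Nat.mul_one]
    omega
  have hmod : ((m1 - 1 - r) + m1 * e) % m1 = m1 - 1 - r := by
    rw [Nat.add_mul_mod_self_left, Nat.mod_eq_of_lt (by omega)]
  have hdiv : ((m1 - 1 - r) + m1 * e) / m1 = e := by
    rw [Nat.add_mul_div_left _ _ (by omega), Nat.div_eq_of_lt (by omega), Nat.zero_add]
  have h2 : ¬ m1 ∣ (m1 - 1 - r) + m1 * e := by
    rw [Nat.dvd_iff_mod_eq_zero, hmod]; omega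
  rw [h, sCol, if_neg (by omega), if_neg h2, hmod, hdiv]
  congr 1 <;> omega

theorem sRow_last (m0 m1 m2 N3 : ℕ) (l0 l1 l2 l3 : ℂ) :
    sRow m0 m1 m2 N3 l0 l1 l2 l3 (m1 * m2) = rowLast m0 m1 m2 N3 l0 l1 l2 l3 := by
  simp [sRow]

theorem sRow_C (m0 m1 m2 N3 : ℕ) (l0 l1 l2 l3 : ℂ) (hm1 : 1 ≤ m1) (j : ℕ)
    (hj : 1 ≤ j) (hj' : j ≤ m2 - 1) :
    sRow m0 m1 m2 N3 l0 l1 l2 l3 (j * m1) = rowC m0 m1 m2 N3 l0 l1 l2 l3 j := by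
  have h0 : j * m1 ≠ m1 * m2 := by
    rw [Nat.mul_comm j m1]
    intro h
    have := Nat.eq_of_mul_eq_mul_left hm1 h
    omega
  rw [sRow, if_neg h0, if_pos (Dvd.intro_left _ rfl), Nat.mul_div_cancel _ hm1]

theorem sRow_F (m0 m1 m2 N3 : ℕ) (l0 l1 l2 l3 : ℂ) (j r : ℕ)
    (hr : 1 ≤ r) (hr' : r ≤ m1 - 1) :
    sRow m0 m1 m2 N3 l0 l1 l2 l3 (r + j * m1) = rowF m0 m1 m2 N3 l0 l1 l2 l3 j r := by
  have hmod : (r + j * m1) % m1 = r := by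
    rw [Nat.add_mul_mod_self_right, Nat.mod_eq_of_lt (by omega)]
  have hdiv : (r + j * m1) / m1 = j := by
    rw [Nat.add_mul_div_right _ _ (by omega), Nat.div_eq_of_lt (by omega), Nat.zero_add]
  have h2 : ¬ m1 ∣ r + j * m1 := by
    rw [Nat.dvd_iff_mod_eq_zero, hmod]; omega
  have h1 : r + j * m1 ≠ m1 * m2 := fun h => h2 (h ▸ Dvd.intro _ rfl)
  rw [sRow, if_neg h1, if_neg h2, hmod, hdiv]

end MGRIT

end

open scoped Matrix ENNReal

noncomputable section

namespace MGRIT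

/-! ### Sums over ranges -/

/-! Because one unitary `X` diagonalizes all `Φ ℓ`, every matrix of the hierarchy has the form
`modal X f`: one scalar matrix in time per eigenmode. Conjugation by `X` preserves Euclidean norms,
so everything reduces to scalar kernels `ℕ → ℕ → ℂ`.

A V-cycle with zero initial guess is a linear operator C_ℓ = Q_ℓ + P_ℓ C_{ℓ+1} R_ℓ with C_3 = A_3⁻¹,
because relaxation does not change the restricted residual (`vCycle_succ_zero`). Let B = R_0 A_0
P_0, the bidiagonal matrix of the step λ₀^{m₀}. Then the level-1 error propagator is 1 - C_1 B
(`coarseErrorPropagator_eq`), whereas the residual, which lives on the C-points, is multiplied by 1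
- B C_1 (`residual_succ`). Both B and C_1 are fixed by transposition combined with time reversal
(`threeLevelKernel_rev`), so 1 - B C_1 is the reversed transpose of 1 - C_1 B
(`one_sub_sysKernel_mul_rev`). Row and column sums merely trade places, and the Schur test
(`norm2_modal_mulVec_le`) gives the bound.

The sums come from a recursion over levels. At an F-column the error kernel is (μ - λ) times the
next column of the cycle kernel (`errKernel_cycleKernel_succ`). At a C-column it is a block term
with that same factor plus a power of λ times the error kernel one level coarser, with μ replaced by
μ λ^{m-1} (`errKernel_cycleKernel_mul`). Starting from μ = λ₀^{m₀}, this produces w₁, w₂, w₃. The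
two summands have disjoint supports, so absolute values add without loss and only geometric sums
remain.

Finally the propagator is strictly lower triangular and invariant under a shift by m₁m₂ points.
Hence the largest column sum occurs among the first m₁m₂ columns and the largest row sum among the
last m₁m₂ rows (`sum_col_shift_le`, `sum_row_le_shift`). -/

theorem sum_range_mul_block {M : Type*} [AddCommMonoid M] (m K : ℕ) (h : ℕ → M) :
    ∑ p ∈ Finset.range (m * K), h p
      = ∑ c ∈ Finset.range K, ∑ i ∈ Finset.range m, h (m * c + i) := by
  induction K with
  | zero => simp
  | succ K ih => rw [Nat.mul_succ, Finset.sum_range_add, ih, Finset.sum_range_succ]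

/-- The geometric sum `1 + x + ⋯ + x ^ (n - 1)`. -/
def gsum (x : ℝ) (n : ℕ) : ℝ := ∑ i ∈ Finset.range n, x ^ i

/-- The bound on the eigenvalues enters here: away from `x = 1` the quotient is a polynomial in `x`,
so the final identities can be closed by `ring`. -/
theorem geo_eq_gsum {x : ℝ} (hx : x < 1) (n : ℕ) : geo x n = gsum x n := by
  have h : 1 - x ≠ 0 := by linarith
  rw [geo, gsum, div_eq_iff h, geom_sum_mul_neg]

theorem sum_pow_eq_gsum (x : ℝ) (n : ℕ) : ∑ i ∈ Finset.range n, x ^ i = gsum x n := rfl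

theorem gsum_zero (x : ℝ) : gsum x 0 = 0 := by simp [gsum]

theorem gsum_reflect (x : ℝ) (n : ℕ) : ∑ j ∈ Finset.range n, x ^ (n - 1 - j) = gsum x n :=
  Finset.sum_range_reflect (fun i => x ^ i) n

theorem sum_range_ite_lt_left (x : ℝ) {i m : ℕ} (hi : i ≤ m) :
    ∑ j ∈ Finset.range m, (if j < i then x ^ (i - j - 1) else 0) = gsum x i := by
  obtain ⟨d, rfl⟩ := Nat.exists_eq_add_of_le hi
  rw [Finset.sum_range_add, ← gsum_reflect, Finset.sum_eq_zero (s := Finset.range d), add_zero]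
  · refine Finset.sum_congr rfl fun j hj => ?_
    rw [if_pos (Finset.mem_range.1 hj)]
    congr 1; omega
  · intro j _
    rw [if_neg (by omega)]

theorem sum_range_ite_lt_right (x : ℝ) {j m : ℕ} (hj : j < m) :
    ∑ i ∈ Finset.range m, (if j < i then x ^ (i - j - 1) else 0) = gsum x (m - 1 - j) := by
  obtain ⟨d, rfl⟩ := Nat.exists_eq_add_of_lt hj
  rw [show j + d + 1 = (j + 1) + d by omega, Finset.sum_range_add,
    Finset.sum_eq_zero (s := Finset.range (j + 1)), zero_add, gsum]
  · rw [show j + 1 + d - 1 - j = d by omega]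
    refine Finset.sum_congr rfl fun i _ => ?_
    rw [if_pos (by omega)]
    congr 1; omega
  · intro i hi
    have := Finset.mem_range.1 hi
    rw [if_neg (by omega)]

/-! ### Kernels of the multilevel approximate inverses -/

/-- Unit lower triangular kernels. -/
structure UnitLower (κ : ℕ → ℕ → ℂ) : Prop where
  lower : ∀ {p q}, p < q → κ p q = 0
  diag : ∀ p, κ p p = 1

/-- The kernel of `A⁻¹`. -/
def invKernel (l : ℂ) (p q : ℕ) : ℂ := if q ≤ p then l ^ (p - q) else 0

/-- The kernel of the F-relaxation `S (Sᵀ A S)⁻¹ Sᵀ`. -/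
def fKernel (m : ℕ) (l : ℂ) (p q : ℕ) : ℂ :=
  if q ≤ p ∧ p < m * ((q + m - 1) / m) then l ^ (p - q) else 0

/-- The kernel of `Q + P C R` where `C` has the kernel `κ`. -/
def cycleKernel (m : ℕ) (l : ℂ) (κ : ℕ → ℕ → ℂ) (p q : ℕ) : ℂ :=
  fKernel m l p q + l ^ (p % m) * κ (p / m) ((q + m - 1) / m) * l ^ (m * ((q + m - 1) / m) - q)

/-- The kernel of `1 - C A`, where `C` has the unit lower triangular kernel `κ` and `A` is the
bidiagonal matrix with subdiagonal `-μ`. -/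
def errKernel (μ : ℂ) (κ : ℕ → ℕ → ℂ) (p q : ℕ) : ℂ :=
  if q < p then μ * κ p (q + 1) - κ p q else 0

theorem unitLower_invKernel (l : ℂ) : UnitLower (invKernel l) where
  lower h := if_neg (by omega)
  diag p := by simp [invKernel]

/-- The expression `(q + m - 1) / m` is the ceiling of q/m, the coarse index of the first C-point at
or after `q`; restriction sends `q` there. -/
theorem ceil_mul {m : ℕ} (hm : 1 ≤ m) (c : ℕ) : (m * c + m - 1) / m = c := by
  rw [show m * c + m - 1 = (m - 1) + m * c by omega, Nat.add_mul_div_left _ _ hm,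
    Nat.div_eq_of_lt (by omega), zero_add]

theorem ceil_mul_add_succ {m j : ℕ} (hj : j < m) (c : ℕ) :
    (m * c + j + 1 + m - 1) / m = c + 1 := by
  rw [show m * c + j + 1 + m - 1 = j + m * (c + 1) by rw [Nat.mul_succ]; omega,
    Nat.add_mul_div_left _ _ (by omega), Nat.div_eq_of_lt hj, zero_add]

theorem mul_add_div_self {m i : ℕ} (hi : i < m) (P : ℕ) : (m * P + i) / m = P := by
  rw [add_comm, Nat.add_mul_div_left _ _ (by omega), Nat.div_eq_of_lt hi, zero_add]

theorem mul_add_mod_self {m i : ℕ} (hi : i < m) (P : ℕ) : (m * P + i) % m = i := by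
  rw [Nat.mul_add_mod, Nat.mod_eq_of_lt hi]

theorem fKernel_mul {m : ℕ} (hm : 1 ≤ m) (l : ℂ) (p c : ℕ) : fKernel m l p (m * c) = 0 := by
  rw [fKernel, ceil_mul hm, if_neg (by omega)]

/-- Columns are written `m * c + j + 1` because the points after the C-point `m * c`, up to and
including the next C-point, share the ceiling `c + 1`. For `j = m - 1` the column is that C-point
and the condition `j < i` never holds. -/
theorem fKernel_succ {m i j : ℕ} (hi : i < m) (hj : j < m) (l : ℂ) (P c : ℕ) :
    fKernel m l (m * P + i) (m * c + j + 1) = if P = c ∧ j < i then l ^ (i - j - 1) else 0 := by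
  rw [fKernel, ceil_mul_add_succ hj]
  have h : (m * c + j + 1 ≤ m * P + i ∧ m * P + i < m * (c + 1)) ↔ (P = c ∧ j < i) := by
    constructor
    · rintro ⟨h1, h2⟩
      have h3 : P < c + 1 := by
        by_contra hc
        have := Nat.mul_le_mul_left m (not_lt.1 hc)
        omega
      have h4 : c ≤ P := by
        by_contra hc
        have := Nat.mul_le_mul_left m (Nat.succ_le_of_lt (not_le.1 hc))
        rw [Nat.mul_succ] at this
        omega
      have : P = c := by omega
      subst this
      exact ⟨rfl, by omega⟩
    · rintro ⟨rfl, h⟩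
      rw [Nat.mul_succ]; omega
  simp only [h]
  split_ifs with h1
  · obtain ⟨rfl, _⟩ := h1
    congr 1; omega
  · rfl

theorem cycleKernel_mul {m i : ℕ} (hi : i < m) (l : ℂ) (κ : ℕ → ℕ → ℂ) (P c : ℕ) :
    cycleKernel m l κ (m * P + i) (m * c) = l ^ i * κ P c := by
  rw [cycleKernel, fKernel_mul (by omega), ceil_mul (by omega), mul_add_div_self hi,
    mul_add_mod_self hi]
  simp

theorem cycleKernel_succ {m i j : ℕ} (hi : i < m) (hj : j < m) (l : ℂ) (κ : ℕ → ℕ → ℂ)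
    (P c : ℕ) :
    cycleKernel m l κ (m * P + i) (m * c + j + 1)
      = (if P = c ∧ j < i then l ^ (i - j - 1) else 0)
        + l ^ i * κ P (c + 1) * l ^ (m - 1 - j) := by
  rw [cycleKernel, fKernel_succ hi hj, ceil_mul_add_succ hj, mul_add_div_self hi,
    mul_add_mod_self hi, show m * (c + 1) - (m * c + j + 1) = m - 1 - j by
      rw [Nat.mul_succ]; omega]

theorem exists_mul_add {m : ℕ} (hm : 1 ≤ m) (p : ℕ) : ∃ P i, i < m ∧ p = m * P + i :=
  ⟨p / m, p % m, Nat.mod_lt _ hm, (Nat.div_add_mod p m).symm⟩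

theorem UnitLower.cycleKernel {κ : ℕ → ℕ → ℂ} (hκ : UnitLower κ) {m : ℕ} (hm : 1 ≤ m) (l : ℂ) :
    UnitLower (cycleKernel m l κ) where
  lower := by
    intro p q h
    obtain ⟨P, i, hi, rfl⟩ := exists_mul_add hm p
    obtain ⟨q, rfl⟩ : ∃ q', q = q' + 1 := ⟨q - 1, by omega⟩
    obtain ⟨c, j, hj, rfl⟩ := exists_mul_add hm q
    have h1 : P ≤ c := by
      by_contra hc
      have := Nat.mul_le_mul_left m (Nat.succ_le_of_lt (not_le.1 hc))
      rw [Nat.mul_succ] at this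
      omega
    rw [cycleKernel_succ hi hj, hκ.lower (by omega), if_neg]
    · simp
    · rintro ⟨rfl, h2⟩; omega
  diag := by
    intro p
    obtain ⟨P, i, hi, rfl⟩ := exists_mul_add hm p
    rcases i with _ | i
    · rw [add_zero]
      have := cycleKernel_mul (i := 0) hi l κ P P
      rw [add_zero] at this
      rw [this, hκ.diag]; simp
    · have := cycleKernel_succ hi (show i < m by omega) l κ P P
      rw [add_assoc (m * P)] at this
      rw [this, hκ.lower (by omega)]; simp

theorem errKernel_of_le {p q : ℕ} (h : p ≤ q) (μ : ℂ) (κ : ℕ → ℕ → ℂ) : errKernel μ κ p q = 0 :=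
  if_neg (by omega)

theorem errKernel_invKernel (μ l : ℂ) (p q : ℕ) :
    errKernel μ (invKernel l) p q = (μ - l) * invKernel l p (q + 1) := by
  unfold errKernel invKernel
  split_ifs with h1 h2 h3
  · rw [show p - q = (p - (q + 1)) + 1 by omega, pow_succ]; ring
  all_goals first | omega | simp

/-- Both columns see the same coarse column `c + 1`, and below the diagonal moving one column to the
left multiplies each summand of the kernel by `l`. So `μ` times the next column minus the current
one is `μ - l` times the next. -/
theorem errKernel_cycleKernel_succ {m i j : ℕ} (hi : i < m) (hj : j + 1 < m) (μ l : ℂ)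
    {κ : ℕ → ℕ → ℂ} (hκ : UnitLower κ) (P c : ℕ) :
    errKernel μ (cycleKernel m l κ) (m * P + i) (m * c + j + 1)
      = (μ - l) * cycleKernel m l κ (m * P + i) (m * c + (j + 1) + 1) := by
  by_cases h : m * c + j + 1 < m * P + i
  · rw [errKernel, if_pos h, show m * c + j + 1 + 1 = m * c + (j + 1) + 1 by omega,
      cycleKernel_succ hi hj, cycleKernel_succ hi (show j < m by omega),
      show m - 1 - j = (m - 1 - (j + 1)) + 1 by omega, pow_succ]
    by_cases hP : P = c
    · subst hP
      have h1 : j + 1 < i := by omega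
      rw [if_pos ⟨rfl, h1⟩, if_pos ⟨rfl, by omega⟩,
        show i - j - 1 = (i - (j + 1) - 1) + 1 by omega, pow_succ]
      ring
    · rw [if_neg (by tauto), if_neg (by tauto)]
      ring
  · rw [errKernel_of_le (not_lt.1 h), (hκ.cycleKernel (by omega) l).lower (by omega), mul_zero]

/-- Here the column and its successor see the coarse columns `c` and `c + 1`, and the successor
carries the extra power `l ^ (m - 1)`; this turns `μ` into `μ * l ^ (m - 1)` on the coarser level.
In the diagonal block the coarse error kernel vanishes, and the unit diagonal of `κ` leaves the
first summand. The exponent keeps the shape `i - 0 - 1` to match `sum_range_ite_lt_right`. -/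
theorem errKernel_cycleKernel_mul {m i : ℕ} (hi : i < m) (μ l : ℂ)
    {κ : ℕ → ℕ → ℂ} (hκ : UnitLower κ) (P c : ℕ) :
    errKernel μ (cycleKernel m l κ) (m * P + i) (m * c)
      = (if P = c ∧ 0 < i then (μ - l) * l ^ (i - 0 - 1) else 0)
        + l ^ i * errKernel (μ * l ^ (m - 1)) κ P c := by
  have key := cycleKernel_succ hi (show 0 < m by omega) l κ P c
  rw [add_zero, Nat.sub_zero, Nat.sub_zero] at key
  rcases lt_trichotomy P c with h | rfl | h
  · have h1 : m * P + i ≤ m * c := by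
      have := Nat.mul_le_mul_left m (Nat.succ_le_of_lt h)
      rw [Nat.mul_succ] at this
      omega
    rw [errKernel_of_le h1, errKernel_of_le h.le, if_neg (by omega)]; simp
  · rw [errKernel_of_le (le_refl P)]
    rcases i with _ | i
    · rw [errKernel_of_le (by omega)]; simp
    · rw [errKernel, if_pos (by omega), key, cycleKernel_mul hi, hκ.lower (Nat.lt_succ_self P),
        hκ.diag, if_pos ⟨rfl, by omega⟩, if_pos ⟨rfl, by omega⟩]
      simp [pow_succ]; ring
  · have h1 : m * c < m * P + i := by
      have := Nat.mul_le_mul_left m (Nat.succ_le_of_lt h)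
      rw [Nat.mul_succ] at this
      omega
    rw [errKernel, if_pos h1, key, cycleKernel_mul hi, errKernel, if_pos h, if_neg (by omega),
      if_neg (by omega)]
    ring

/-! ### Shift invariance and persymmetry -/

theorem invKernel_shift (l : ℂ) (s p q : ℕ) : invKernel l (p + s) (q + s) = invKernel l p q := by
  simp [invKernel, Nat.add_sub_add_right]

theorem cycleKernel_shift {m : ℕ} (hm : 1 ≤ m) (l : ℂ) {κ : ℕ → ℕ → ℂ} {s : ℕ}
    (h : ∀ p q, κ (p + s) (q + s) = κ p q) (p q : ℕ) :
    cycleKernel m l κ (p + m * s) (q + m * s) = cycleKernel m l κ p q := by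
  have h1 : (q + m * s + m - 1) / m = (q + m - 1) / m + s := by
    rw [show q + m * s + m - 1 = (q + m - 1) + m * s by omega, Nat.add_mul_div_left _ _ hm]
  have h2 : (p + m * s) / m = p / m + s := Nat.add_mul_div_left _ _ hm
  have h3 : (p + m * s) % m = p % m := Nat.add_mul_mod_self_left _ _ _
  rw [cycleKernel, cycleKernel, fKernel, fKernel, h1, h2, h3, h, Nat.mul_add,
    Nat.add_sub_add_right, Nat.add_sub_add_right]
  simp

theorem errKernel_shift (μ : ℂ) {κ : ℕ → ℕ → ℂ} {s : ℕ}
    (h : ∀ p q, κ (p + s) (q + s) = κ p q) (p q : ℕ) :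
    errKernel μ κ (p + s) (q + s) = errKernel μ κ p q := by
  rw [errKernel, errKernel, h, show q + s + 1 = q + 1 + s by omega, h]
  simp

theorem invKernel_rev (l : ℂ) {K p q : ℕ} (hp : p ≤ K) (hq : q ≤ K) :
    invKernel l (K - q) (K - p) = invKernel l p q := by
  unfold invKernel
  split_ifs
  · congr 1; omega
  all_goals first | omega | rfl

theorem cycleKernel_rev {m : ℕ} (hm : 1 ≤ m) (l : ℂ) {κ : ℕ → ℕ → ℂ} {K : ℕ}
    (h : ∀ p q, p ≤ K → q ≤ K → κ (K - q) (K - p) = κ p q) {p q : ℕ} (hp : p ≤ m * K)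
    (hq : q ≤ m * K) :
    cycleKernel m l κ (m * K - q) (m * K - p) = cycleKernel m l κ p q := by
  -- The reflection p ↦ mK - p exchanges floor and ceiling of p/m, and the distance to the previous
  -- C-point with the distance to the next one.
  have aux : ∀ p, p ≤ m * K → (m * K - p) / m = K - (p + m - 1) / m ∧
      (m * K - p) % m = m * ((p + m - 1) / m) - p ∧ (m * K - p + m - 1) / m = K - p / m ∧
      m * (K - p / m) - (m * K - p) = p % m ∧ p / m ≤ K ∧ (p + m - 1) / m ≤ K := by
    intro p hp
    obtain ⟨P, i, hi, rfl⟩ := exists_mul_add hm p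
    rw [mul_add_div_self hi, mul_add_mod_self hi]
    have hPK : P ≤ K := by
      by_contra hc
      have := Nat.mul_le_mul_left m (Nat.succ_le_of_lt (not_le.1 hc))
      rw [Nat.mul_succ] at this
      omega
    obtain ⟨D, rfl⟩ := Nat.exists_eq_add_of_le hPK
    rw [Nat.mul_add] at *
    rcases i with _ | i
    · have e1 : m * P + m * D - (m * P + 0) = m * D + 0 := by omega
      rw [add_zero, ceil_mul hm]
      rw [add_zero] at e1
      rw [e1, mul_add_div_self hi, mul_add_mod_self hi, add_zero, ceil_mul hm,
        Nat.add_sub_cancel_left]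
      omega
    · obtain ⟨D, rfl⟩ : ∃ d, D = d + 1 := ⟨D - 1, by
        rcases D with _ | D
        · omega
        · omega⟩
      have e1 : m * P + m * (D + 1) - (m * P + (i + 1)) = m * D + (m - 1 - i) := by
        rw [Nat.mul_succ]; omega
      have e2 : m * D + (m - 1 - i) + m - 1 = m * D + (m - 2 - i) + 1 + m - 1 := by omega
      rw [e1, mul_add_div_self (by omega), mul_add_mod_self (by omega), e2,
        ceil_mul_add_succ (by omega), ← add_assoc (m * P), ceil_mul_add_succ (by omega),
        show P + (D + 1) - P = D + 1 by omega, Nat.mul_succ, Nat.mul_succ]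
      omega
  obtain ⟨p1, p2, p3, p4, p5, p6⟩ := aux p hp
  obtain ⟨q1, q2, q3, q4, q5, q6⟩ := aux q hq
  rw [cycleKernel, cycleKernel, q1, q2, p3, p4, h _ _ p5 q6, fKernel, fKernel, p3]
  congr 1
  · have hc : (m * K - p ≤ m * K - q ∧ m * K - q < m * (K - p / m)) ↔
        (q ≤ p ∧ p < m * ((q + m - 1) / m)) := by
      have e1 : m * K - q = m * (K - (q + m - 1) / m) + (m * ((q + m - 1) / m) - q) := by
        rw [← q1, ← q2, Nat.div_add_mod]
      have e2 : p = m * (p / m) + p % m := (Nat.div_add_mod p m).symm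
      have e3 := Nat.mod_lt p hm
      have e4 := Nat.mod_lt (m * K - q) hm
      rw [q2] at e4
      have e5 : m * K - q < m * (K - p / m) ↔ p < m * ((q + m - 1) / m) := by
        rw [mul_comm m (K - _), mul_comm m (_ / m), ← Nat.div_lt_iff_lt_mul hm, q1,
          ← Nat.div_lt_iff_lt_mul hm]
        omega
      rw [e5]; omega
    simp only [hc]
    split_ifs
    · congr 1; omega
    · rfl
  · ring

/-! ### Weighted column and row sums -/

/-- Column sum in which all rows but the last one have the weight `α`. -/
def colWeight (α : ℝ) (κ : ℕ → ℕ → ℂ) (K q : ℕ) : ℝ :=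
  α * ∑ p ∈ Finset.range K, ‖κ p q‖ + ‖κ K q‖

/-- Row sum over the columns `0, …, K - 1`. -/
def rowSum (κ : ℕ → ℕ → ℂ) (K p : ℕ) : ℝ := ∑ q ∈ Finset.range K, ‖κ p q‖

theorem colWeight_const_mul (α : ℝ) (z : ℂ) (κ : ℕ → ℕ → ℂ) (K q : ℕ) {e : ℕ → ℕ → ℂ} {q' : ℕ}
    (h : ∀ p ≤ K, e p q' = z * κ p q) : colWeight α e K q' = ‖z‖ * colWeight α κ K q := by
  unfold colWeight
  rw [h K le_rfl, Finset.sum_congr rfl fun p hp => by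
    rw [h p (Finset.mem_range.1 hp).le, norm_mul], ← Finset.mul_sum, norm_mul]
  ring

theorem colWeight_invKernel (α : ℝ) (l : ℂ) {K q : ℕ} (hq : q ≤ K) :
    colWeight α (invKernel l) K q = α * gsum ‖l‖ (K - q) + ‖l‖ ^ (K - q) := by
  obtain ⟨d, rfl⟩ := Nat.exists_eq_add_of_le hq
  rw [colWeight, Finset.sum_range_add, Finset.sum_eq_zero (s := Finset.range q), zero_add,
    invKernel, if_pos hq, norm_pow, gsum, Nat.add_sub_cancel_left]
  · congr 2
    refine Finset.sum_congr rfl fun p _ => ?_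
    rw [invKernel, if_pos (by omega), norm_pow, Nat.add_sub_cancel_left]
  · intro p hp
    rw [(unitLower_invKernel l).lower (Finset.mem_range.1 hp), norm_zero]

/-- Norm of a sum whose second summand vanishes as soon as the condition of the first one holds. -/
theorem norm_ite_add {c : Prop} [Decidable c] {x y : ℂ} (h : c → y = 0) :
    ‖(if c then x else 0) + y‖ = (if c then ‖x‖ else 0) + ‖y‖ := by
  by_cases hc : c
  · simp [hc, h hc]
  · simp [hc]

theorem sum_sum_ite_and {K m c : ℕ} (hc : c < K) (s : ℕ → Prop) [DecidablePred s] (f : ℕ → ℝ) :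
    ∑ P ∈ Finset.range K, ∑ i ∈ Finset.range m, (if P = c ∧ s i then f i else 0)
      = ∑ i ∈ Finset.range m, (if s i then f i else 0) := by
  rw [Finset.sum_eq_single_of_mem c (Finset.mem_range.2 hc)]
  · simp
  · intro P _ hP
    exact Finset.sum_eq_zero fun i _ => if_neg (by tauto)

/-- Each coarse row before the last expands to `m` fine rows with factors 1, ‖l‖, …, ‖l‖^(m-1),
while the last row `m * K` is a lone C-point. So the weight of all rows but the last grows from `α`
to `α * gsum ‖l‖ m`, which is why column sums carry a weight. -/
theorem colWeight_cycleKernel {m j c K : ℕ} (hj : j < m) (hc : c < K) (α : ℝ) (l : ℂ)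
    {κ : ℕ → ℕ → ℂ} (hκ : UnitLower κ) :
    colWeight α (cycleKernel m l κ) (m * K) (m * c + j + 1)
      = α * gsum ‖l‖ (m - 1 - j)
        + ‖l‖ ^ (m - 1 - j) * colWeight (α * gsum ‖l‖ m) κ K (c + 1) := by
  have hlast := cycleKernel_succ (show 0 < m by omega) hj l κ K c
  rw [add_zero, if_neg (by omega)] at hlast
  have hn : ∀ P ∈ Finset.range K, ∀ i ∈ Finset.range m,
      ‖cycleKernel m l κ (m * P + i) (m * c + j + 1)‖
        = (if P = c ∧ j < i then ‖l‖ ^ (i - j - 1) else 0)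
          + ‖l‖ ^ i * (‖κ P (c + 1)‖ * ‖l‖ ^ (m - 1 - j)) := by
    intro P _ i hi
    rw [cycleKernel_succ (Finset.mem_range.1 hi) hj, norm_ite_add]
    · simp only [norm_mul, norm_pow]; ring_nf
    · rintro ⟨rfl, _⟩
      rw [hκ.lower (Nat.lt_succ_self _)]; simp
  rw [colWeight, sum_range_mul_block, hlast,
    Finset.sum_congr rfl fun P hP => Finset.sum_congr rfl fun i hi => hn P hP i hi]
  simp only [Finset.sum_add_distrib]
  rw [sum_sum_ite_and hc, sum_range_ite_lt_right _ hj]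
  simp only [← Finset.sum_mul]
  rw [← Finset.mul_sum, ← Finset.sum_mul, colWeight, ← gsum]
  simp only [zero_add, norm_mul, norm_pow]
  ring

theorem colWeight_errKernel_cycleKernel_succ {m j c K : ℕ} (hj : j + 1 < m) (hc : c < K) (α : ℝ)
    (μ l : ℂ) {κ : ℕ → ℕ → ℂ} (hκ : UnitLower κ) :
    colWeight α (errKernel μ (cycleKernel m l κ)) (m * K) (m * c + j + 1)
      = ‖μ - l‖ * (α * gsum ‖l‖ (m - 2 - j)
        + ‖l‖ ^ (m - 2 - j) * colWeight (α * gsum ‖l‖ m) κ K (c + 1)) := by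
  rw [show m - 2 - j = m - 1 - (j + 1) by omega, ← colWeight_cycleKernel hj hc α l hκ]
  refine colWeight_const_mul _ _ _ _ _ fun p _ => ?_
  obtain ⟨P, i, hi, rfl⟩ := exists_mul_add (show 1 ≤ m by omega) p
  exact errKernel_cycleKernel_succ hi hj μ l hκ P c

theorem colWeight_errKernel_cycleKernel_mul {m c K : ℕ} (hm : 1 ≤ m) (hc : c < K) (α : ℝ)
    (μ l : ℂ) {κ : ℕ → ℕ → ℂ} (hκ : UnitLower κ) :
    colWeight α (errKernel μ (cycleKernel m l κ)) (m * K) (m * c)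
      = α * ‖μ - l‖ * gsum ‖l‖ (m - 1)
        + colWeight (α * gsum ‖l‖ m) (errKernel (μ * l ^ (m - 1)) κ) K c := by
  have hlast := errKernel_cycleKernel_mul (show 0 < m by omega) μ l hκ K c
  rw [add_zero, if_neg (by omega)] at hlast
  have hn : ∀ P ∈ Finset.range K, ∀ i ∈ Finset.range m,
      ‖errKernel μ (cycleKernel m l κ) (m * P + i) (m * c)‖
        = ‖μ - l‖ * (if P = c ∧ 0 < i then ‖l‖ ^ (i - 0 - 1) else 0)
          + ‖l‖ ^ i * ‖errKernel (μ * l ^ (m - 1)) κ P c‖ := by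
    intro P _ i hi
    rw [errKernel_cycleKernel_mul (Finset.mem_range.1 hi) μ l hκ, norm_ite_add]
    · simp only [norm_mul, norm_pow, mul_ite, mul_zero]
    · rintro ⟨rfl, _⟩
      rw [errKernel_of_le le_rfl]; simp
  rw [colWeight, sum_range_mul_block, hlast,
    Finset.sum_congr rfl fun P hP => Finset.sum_congr rfl fun i hi => hn P hP i hi]
  simp only [Finset.sum_add_distrib, ← Finset.mul_sum]
  rw [sum_sum_ite_and hc, sum_range_ite_lt_right _ (by omega)]
  simp only [← Finset.sum_mul]
  rw [← Finset.mul_sum, colWeight, ← gsum]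
  simp only [zero_add, pow_zero, one_mul, Nat.sub_zero]
  ring

/-! ### Row sums of the kernels -/

theorem rowSum_succ_invKernel (l : ℂ) {K p : ℕ} (hp : p ≤ K) :
    rowSum (fun p q => invKernel l p (q + 1)) K p = gsum ‖l‖ p := by
  rw [rowSum, ← sum_range_ite_lt_left _ hp]
  refine Finset.sum_congr rfl fun q _ => ?_
  rw [invKernel]
  by_cases h : q < p
  · rw [if_pos h, if_pos (Nat.succ_le_of_lt h), norm_pow, Nat.sub_sub]
  · rw [if_neg h, if_neg (by omega), norm_zero]

theorem rowSum_errKernel_invKernel (μ l : ℂ) {K p : ℕ} (hp : p ≤ K) :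
    rowSum (errKernel μ (invKernel l)) K p = ‖μ - l‖ * gsum ‖l‖ p := by
  rw [← rowSum_succ_invKernel l hp, rowSum, rowSum, Finset.mul_sum]
  refine Finset.sum_congr rfl fun q _ => ?_
  rw [errKernel_invKernel, norm_mul]

/-- The value `P = K` occurs only for the final row, a C-point with `i = 0`, where `j < i` is void.
-/
theorem sum_sum_ite_and_of_le {K m P i : ℕ} (hP : i = 0 ∨ P < K) (f : ℕ → ℝ) :
    ∑ c ∈ Finset.range K, ∑ j ∈ Finset.range m, (if P = c ∧ j < i then f j else 0)
      = ∑ j ∈ Finset.range m, (if j < i then f j else 0) := by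
  rcases hP with rfl | hP
  · simp
  · rw [← sum_sum_ite_and hP (fun j => j < i) f]
    simp only [eq_comm]

/-- Column 0 is left out because the F-columns of interval `c` refer to the coarse column `c + 1`;
omitting it on the fine level omits it on the coarse level too. -/
theorem rowSum_succ_cycleKernel {m i P K : ℕ} (hi : i < m) (hP : i = 0 ∨ P < K) (l : ℂ)
    {κ : ℕ → ℕ → ℂ} (hκ : UnitLower κ) :
    rowSum (fun p q => cycleKernel m l κ p (q + 1)) (m * K) (m * P + i)
      = gsum ‖l‖ i + ‖l‖ ^ i * (gsum ‖l‖ m * rowSum (fun p q => κ p (q + 1)) K P) := by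
  have hn : ∀ c ∈ Finset.range K, ∀ j ∈ Finset.range m,
      ‖cycleKernel m l κ (m * P + i) (m * c + j + 1)‖
        = (if P = c ∧ j < i then ‖l‖ ^ (i - j - 1) else 0)
          + ‖l‖ ^ i * (‖κ P (c + 1)‖ * ‖l‖ ^ (m - 1 - j)) := by
    intro c _ j hj
    rw [cycleKernel_succ hi (Finset.mem_range.1 hj), norm_ite_add]
    · simp only [norm_mul, norm_pow]; ring_nf
    · rintro ⟨rfl, _⟩
      rw [hκ.lower (Nat.lt_succ_self _)]; simp
  rw [rowSum, sum_range_mul_block,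
    Finset.sum_congr rfl fun P hP => Finset.sum_congr rfl fun i hi => hn P hP i hi]
  simp only [Finset.sum_add_distrib]
  rw [sum_sum_ite_and_of_le hP, sum_range_ite_lt_left _ hi.le]
  simp only [← Finset.mul_sum, gsum_reflect]
  rw [← Finset.sum_mul, rowSum]
  ring

/-- Every interval has one C-column, which hands over the coarse error kernel, and `m - 1`
F-columns, which add up to `gsum ‖l‖ (m - 1)` times the coarse column `c + 1`. The diagonal-block
entries of both kinds together form one geometric sum of length `i`. -/
theorem rowSum_errKernel_cycleKernel {m i P K : ℕ} (hi : i < m) (hP : i = 0 ∨ P < K) (μ l : ℂ)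
    {κ : ℕ → ℕ → ℂ} (hκ : UnitLower κ) :
    rowSum (errKernel μ (cycleKernel m l κ)) (m * K) (m * P + i)
      = ‖μ - l‖ * gsum ‖l‖ i
        + ‖l‖ ^ i * (‖μ - l‖ * gsum ‖l‖ (m - 1) * rowSum (fun p q => κ p (q + 1)) K P
          + rowSum (errKernel (μ * l ^ (m - 1)) κ) K P) := by
  obtain ⟨n, rfl⟩ : ∃ n, m = n + 1 := ⟨m - 1, by omega⟩
  have hr : ∑ j ∈ Finset.range n, ‖l‖ ^ (n - Nat.succ j) = gsum ‖l‖ n := by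
    rw [← gsum_reflect]
    exact Finset.sum_congr rfl fun j _ => by congr 1; omega
  have hn : ∀ c ∈ Finset.range K, ∑ j ∈ Finset.range (n + 1),
      ‖errKernel μ (cycleKernel (n + 1) l κ) ((n + 1) * P + i) ((n + 1) * c + j)‖
        = ‖μ - l‖ * ∑ j ∈ Finset.range (n + 1), (if P = c ∧ j < i then ‖l‖ ^ (i - j - 1) else 0)
          + ‖l‖ ^ i * (‖μ - l‖ * gsum ‖l‖ n * ‖κ P (c + 1)‖
            + ‖errKernel (μ * l ^ n) κ P c‖) := by
    intro c _
    -- The C-column `j = 0` is split off on both sides.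
    rw [Finset.sum_range_succ', Finset.sum_range_succ', Finset.sum_congr rfl fun j hj => by
      rw [← add_assoc ((n + 1) * c), errKernel_cycleKernel_succ hi
        (Nat.succ_lt_succ (Finset.mem_range.1 hj)) μ l hκ, norm_mul,
        cycleKernel_succ hi (Nat.succ_lt_succ (Finset.mem_range.1 hj)), norm_ite_add (by
          rintro ⟨rfl, _⟩
          rw [hκ.lower (Nat.lt_succ_self _)]; simp)],
      add_zero, errKernel_cycleKernel_mul hi μ l hκ, norm_ite_add (by
          rintro ⟨rfl, _⟩
          rw [errKernel_of_le le_rfl]; simp), ← Finset.mul_sum, Finset.sum_add_distrib]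
    simp only [norm_mul, norm_pow, Nat.add_sub_cancel]
    rw [← Finset.mul_sum, hr, mul_add, mul_add]
    simp only [mul_ite, mul_zero, Nat.succ_eq_add_one]
    ring
  rw [rowSum, sum_range_mul_block, Finset.sum_congr rfl hn]
  simp only [Finset.sum_add_distrib, ← Finset.mul_sum]
  rw [sum_sum_ite_and_of_le hP, sum_range_ite_lt_left _ hi.le, Nat.add_sub_cancel]
  rfl

/-! ### The explicit sums for one spatial mode -/

/-- The kernel of the approximate inverse of a three-level V-cycle. -/
def threeLevelKernel (m1 m2 : ℕ) (l1 l2 l3 : ℂ) : ℕ → ℕ → ℂ :=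
  cycleKernel m1 l1 (cycleKernel m2 l2 (invKernel l3))

/-- The kernel of the level-`1` error propagator. -/
def propKernel (m0 m1 m2 : ℕ) (l0 l1 l2 l3 : ℂ) : ℕ → ℕ → ℂ :=
  errKernel (l0 ^ m0) (threeLevelKernel m1 m2 l1 l2 l3)

section Mode

variable {m0 m1 m2 : ℕ} {l0 l1 l2 l3 : ℂ}

theorem unitLower_twoLevel (hm2 : 1 ≤ m2) : UnitLower (cycleKernel m2 l2 (invKernel l3)) :=
  (unitLower_invKernel l3).cycleKernel hm2 l2

theorem unitLower_threeLevelKernel (hm1 : 1 ≤ m1) (hm2 : 1 ≤ m2) :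
    UnitLower (threeLevelKernel m1 m2 l1 l2 l3) :=
  (unitLower_twoLevel hm2).cycleKernel hm1 l1

theorem propKernel_of_le {p q : ℕ} (h : p ≤ q) : propKernel m0 m1 m2 l0 l1 l2 l3 p q = 0 :=
  errKernel_of_le h _ _

/-- One point on level 3 is `m2` points on level 2 and `m1 * m2` points on level 1. -/
theorem propKernel_shift (hm1 : 1 ≤ m1) (hm2 : 1 ≤ m2) (p q : ℕ) :
    propKernel m0 m1 m2 l0 l1 l2 l3 (p + m1 * m2) (q + m1 * m2)
      = propKernel m0 m1 m2 l0 l1 l2 l3 p q := by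
  refine errKernel_shift _ (cycleKernel_shift hm1 _ fun p q => ?_) p q
  have h := cycleKernel_shift hm2 l2 (invKernel_shift l3 1) p q
  rwa [mul_one] at h

theorem threeLevelKernel_rev (hm1 : 1 ≤ m1) (hm2 : 1 ≤ m2) {K p q : ℕ}
    (hp : p ≤ m1 * (m2 * K)) (hq : q ≤ m1 * (m2 * K)) :
    threeLevelKernel m1 m2 l1 l2 l3 (m1 * (m2 * K) - q) (m1 * (m2 * K) - p)
      = threeLevelKernel m1 m2 l1 l2 l3 p q :=
  cycleKernel_rev hm1 _ (fun _ _ => cycleKernel_rev hm2 _ fun _ _ => invKernel_rev _) hp hq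

/-- Column sum of the coarse part of the propagator. -/
theorem colWeight_twoLevel {j K : ℕ} (hj : j < m2) (hK : 1 ≤ K) (α : ℝ) :
    colWeight α (cycleKernel m2 l2 (invKernel l3)) (m2 * K) (j + 1)
      = α * gsum ‖l2‖ (m2 - 1 - j) + ‖l2‖ ^ (m2 - 1 - j) *
          (α * gsum ‖l2‖ m2 * gsum ‖l3‖ (K - 1) + ‖l3‖ ^ (K - 1)) := by
  have h := colWeight_cycleKernel (c := 0) hj hK α l2 (unitLower_invKernel l3)
  rwa [mul_zero, zero_add, zero_add, colWeight_invKernel _ _ hK] at h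

theorem colWeight_errKernel_twoLevel_zero {K : ℕ} (hm2 : 1 ≤ m2) (hK : 1 ≤ K) (α : ℝ) (μ : ℂ) :
    colWeight α (errKernel μ (cycleKernel m2 l2 (invKernel l3))) (m2 * K) 0
      = α * ‖μ - l2‖ * gsum ‖l2‖ (m2 - 1) + ‖μ * l2 ^ (m2 - 1) - l3‖ *
          (α * gsum ‖l2‖ m2 * gsum ‖l3‖ (K - 1) + ‖l3‖ ^ (K - 1)) := by
  have h := colWeight_errKernel_cycleKernel_mul (c := 0) hm2 hK α μ l2 (unitLower_invKernel l3)
  rw [mul_zero] at h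
  rw [h, ← colWeight_invKernel _ _ hK]
  congr 1
  exact colWeight_const_mul _ _ _ _ _ fun p _ => errKernel_invKernel _ _ p 0

theorem colWeight_errKernel_twoLevel_succ {j K : ℕ} (hj : j + 1 < m2) (hK : 1 ≤ K) (α : ℝ)
    (μ : ℂ) :
    colWeight α (errKernel μ (cycleKernel m2 l2 (invKernel l3))) (m2 * K) (j + 1)
      = ‖μ - l2‖ * (α * gsum ‖l2‖ (m2 - 2 - j) + ‖l2‖ ^ (m2 - 2 - j) *
          (α * gsum ‖l2‖ m2 * gsum ‖l3‖ (K - 1) + ‖l3‖ ^ (K - 1))) := by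
  have h := colWeight_errKernel_cycleKernel_succ (c := 0) hj hK α μ l2 (unitLower_invKernel l3)
  rwa [mul_zero, zero_add, zero_add, colWeight_invKernel _ _ hK] at h

/-- The weight is 1 on level 1, `gsum ‖l1‖ m1` on level 2, and that times `gsum ‖l2‖ m2` on level 3;
together with the separate last row the coarsest level contributes the factor G. -/
theorem colWeight_propKernel (hm1 : 1 ≤ m1) (hm2 : 1 ≤ m2) {N3 : ℕ} (hN3 : 2 ≤ N3)
    (h1 : ‖l1‖ < 1) (h2 : ‖l2‖ < 1) (h3 : ‖l3‖ < 1) {d : ℕ} (hd : d < m1 * m2) :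
    colWeight 1 (propKernel m0 m1 m2 l0 l1 l2 l3) (m1 * (m2 * (N3 - 1))) d
      = sCol m0 m1 m2 N3 l0 l1 l2 l3 d := by
  have hK : 1 ≤ N3 - 1 := by omega
  have hN : N3 - 2 = N3 - 1 - 1 := by omega
  obtain ⟨c, i, hi, rfl⟩ := exists_mul_add hm1 d
  have hc : c < m2 := by
    by_contra hc
    have := Nat.mul_le_mul_left m1 (not_lt.1 hc)
    omega
  have hcK : c < m2 * (N3 - 1) := lt_of_lt_of_le hc (Nat.le_mul_of_pos_right _ hK)
  rcases i with _ | i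
  · rw [add_zero, propKernel, threeLevelKernel,
      colWeight_errKernel_cycleKernel_mul hm1 hcK _ _ _ (unitLower_twoLevel hm2)]
    -- Column 0 is a C-point on levels 1 and 2, so the recursion reaches level 3; the other
    -- C-columns in range are F-points of level 2 and stop there.
    rcases c with _ | c
    · rw [colWeight_errKernel_twoLevel_zero hm2 hK, mul_zero, sCol_zero, colFirst]
      simp only [geo_eq_gsum h1, geo_eq_gsum h2, geo_eq_gsum h3, w1, w2, w3, hN]
      rw [norm_sub_rev l1, norm_sub_rev l2, norm_sub_rev l3]
      ring
    · have h0 : m1 * (c + 1) ≠ 0 := Nat.mul_ne_zero (by omega) (by omega)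
      rw [colWeight_errKernel_twoLevel_succ hc hK, sCol, if_neg h0,
        if_pos (Dvd.intro _ rfl), Nat.mul_div_cancel_left _ hm1, colC,
        show m2 - (c + 1) - 1 = m2 - 2 - c by omega]
      simp only [geo_eq_gsum h1, geo_eq_gsum h2, geo_eq_gsum h3, w1, w2, hN, sum_pow_eq_gsum]
      rw [norm_sub_rev l1, norm_sub_rev l2]
      ring
  · have hmod : (m1 * c + (i + 1)) % m1 = i + 1 := mul_add_mod_self hi c
    have hnd : ¬ m1 ∣ m1 * c + (i + 1) := by
      rw [Nat.dvd_iff_mod_eq_zero, hmod]; omega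
    rw [sCol, if_neg (by omega), if_neg hnd, hmod, mul_add_div_self hi, ← add_assoc, propKernel,
      threeLevelKernel,
      colWeight_errKernel_cycleKernel_succ hi hcK _ _ _ (unitLower_twoLevel hm2),
      colWeight_twoLevel hc hK, colF, show m1 - 1 - (i + 1) = m1 - 2 - i by omega]
    simp only [geo_eq_gsum h1, geo_eq_gsum h2, geo_eq_gsum h3, w1, hN, sum_pow_eq_gsum]
    rw [norm_sub_rev l1]
    ring

/-- Only the last row has `P = K`; `P` is `N3 - 1` for that row and `N3 - 2` for the others in the
last interval. -/
theorem rowSum_propKernel_eq {i j P K : ℕ} (hi : i < m1) (hj : j < m2)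
    (hij : P < K ∨ P = K ∧ i = 0 ∧ j = 0) :
    rowSum (propKernel m0 m1 m2 l0 l1 l2 l3) (m1 * (m2 * K)) (m1 * (m2 * P + j) + i)
      = w1 m0 l0 l1 * gsum ‖l1‖ i + ‖l1‖ ^ i *
        (w1 m0 l0 l1 * gsum ‖l1‖ (m1 - 1) *
            (gsum ‖l2‖ j + ‖l2‖ ^ j * (gsum ‖l2‖ m2 * gsum ‖l3‖ P))
          + (w2 m0 m1 l0 l1 l2 * gsum ‖l2‖ j + ‖l2‖ ^ j *
            (w2 m0 m1 l0 l1 l2 * gsum ‖l2‖ (m2 - 1) * gsum ‖l3‖ P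
              + w3 m0 m1 m2 l0 l1 l2 l3 * gsum ‖l3‖ P))) := by
  have hi' : i = 0 ∨ m2 * P + j < m2 * K := by
    rcases hij with h | h
    · right
      have := Nat.mul_le_mul_left m2 (Nat.succ_le_of_lt h)
      rw [Nat.mul_succ] at this
      omega
    · exact .inl h.2.1
  have hj' : j = 0 ∨ P < K := by
    rcases hij with h | h
    · exact .inr h
    · exact .inl h.2.2
  have hP : P ≤ K := by omega
  rw [propKernel, threeLevelKernel,
    rowSum_errKernel_cycleKernel hi hi' _ _ (unitLower_twoLevel (by omega)),
    rowSum_errKernel_cycleKernel hj hj' _ _ (unitLower_invKernel l3),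
    rowSum_succ_cycleKernel hj hj' _ (unitLower_invKernel l3), rowSum_succ_invKernel _ hP,
    rowSum_errKernel_invKernel _ _ hP, w1, w2, w3, norm_sub_rev l1, norm_sub_rev l2,
    norm_sub_rev l3]

theorem rowSum_propKernel (hm1 : 1 ≤ m1) (hm2 : 1 ≤ m2) {N3 : ℕ} (hN3 : 2 ≤ N3)
    (h1 : ‖l1‖ < 1) (h2 : ‖l2‖ < 1) (h3 : ‖l3‖ < 1) {t : ℕ} (ht : 1 ≤ t) (ht' : t ≤ m1 * m2) :
    rowSum (propKernel m0 m1 m2 l0 l1 l2 l3) (m1 * (m2 * (N3 - 1))) (m1 * (m2 * (N3 - 2)) + t)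
      = sRow m0 m1 m2 N3 l0 l1 l2 l3 t := by
  rcases ht'.eq_or_lt with rfl | hlt
  · have hp : m1 * (m2 * (N3 - 2)) + m1 * m2 = m1 * (m2 * (N3 - 1) + 0) + 0 := by
      rw [show N3 - 1 = N3 - 2 + 1 by omega]; ring
    rw [hp, rowSum_propKernel_eq (by omega) (by omega) (.inr ⟨rfl, rfl, rfl⟩), sRow_last,
      rowLast]
    simp only [geo_eq_gsum h1, geo_eq_gsum h2, geo_eq_gsum h3, gsum_zero, pow_zero]
    ring
  · obtain ⟨j, i, hi, rfl⟩ := exists_mul_add hm1 t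
    have hj : j < m2 := by
      by_contra hc
      have := Nat.mul_le_mul_left m1 (not_lt.1 hc)
      omega
    have hp : m1 * (m2 * (N3 - 2)) + (m1 * j + i) = m1 * (m2 * (N3 - 2) + j) + i := by ring
    rw [hp, rowSum_propKernel_eq hi hj (.inl (by omega))]
    rcases i with _ | i
    · rw [add_zero, sRow, if_neg (by omega), if_pos (Dvd.intro _ rfl),
        Nat.mul_div_cancel_left _ hm1, rowC]
      simp only [geo_eq_gsum h1, geo_eq_gsum h2, geo_eq_gsum h3, gsum_zero, pow_zero]
      ring
    · have hmod : (m1 * j + (i + 1)) % m1 = i + 1 := mul_add_mod_self hi j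
      have hnd : ¬ m1 ∣ m1 * j + (i + 1) := by
        rw [Nat.dvd_iff_mod_eq_zero, hmod]; omega
      rw [sRow, if_neg (by omega), if_neg hnd, hmod, mul_add_div_self hi, rowF]
      simp only [geo_eq_gsum h1, geo_eq_gsum h2, geo_eq_gsum h3, sum_pow_eq_gsum]
      ring

end Mode

/-! ### Matrices with one spatial mode -/

/-- The matrix of a kernel. -/
def kerMat (n n' : ℕ) (f : ℕ → ℕ → ℂ) : Matrix (Fin n) (Fin n') ℂ :=
  Matrix.of fun p q => f p q

theorem kerMat_apply (n n' : ℕ) (f : ℕ → ℕ → ℂ) (p : Fin n) (q : Fin n') :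
    kerMat n n' f p q = f p q := rfl

theorem kerMat_mul_apply {n n' n'' : ℕ} (f g : ℕ → ℕ → ℂ) (p : Fin n) (q : Fin n'') :
    (kerMat n n' f * kerMat n' n'' g) p q = ∑ r ∈ Finset.range n', f p r * g r q := by
  rw [Matrix.mul_apply]
  exact Fin.sum_univ_eq_sum_range (fun r => f p r * g r q) n'

/-- The kernel of the system matrix. -/
def sysKernel (l : ℂ) (p q : ℕ) : ℂ := if p = q then 1 else if p = q + 1 then -l else 0

/-- The kernel of ideal interpolation. -/
def interpKernel (m : ℕ) (l : ℂ) (p c : ℕ) : ℂ :=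
  if c * m ≤ p ∧ p < c * m + m then l ^ (p - c * m) else 0

/-- The kernel of ideal restriction. -/
def restKernel (m : ℕ) (l : ℂ) (c p : ℕ) : ℂ :=
  if p ≤ c * m ∧ c * m < p + m then l ^ (c * m - p) else 0

/-- The kernel of restriction by injection. -/
def injKernel (m : ℕ) (c p : ℕ) : ℂ := if p = c * m then 1 else 0

/-- The embedding of the F-points. -/
def fEmb (n m : ℕ) : Matrix (Fin n) (FPoint n m) ℂ := Matrix.of fun p q => if p = q.1 then 1 else 0

theorem sum_sysKernel_mul (l : ℂ) (g : ℕ → ℂ) {n p : ℕ} (hp : p < n) :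
    ∑ r ∈ Finset.range n, sysKernel l p r * g r = g p - (if 1 ≤ p then l * g (p - 1) else 0) := by
  have h : ∀ r, sysKernel l p r * g r
      = (if r = p then g r else 0) - (if r = p - 1 then (if 1 ≤ p then l * g r else 0) else 0) := by
    intro r
    unfold sysKernel
    split_ifs <;> first | omega | simp
  simp only [h, Finset.sum_sub_distrib, Finset.sum_ite_eq', Finset.mem_range, if_pos hp,
    if_pos (show p - 1 < n by omega)]

theorem sum_mul_sysKernel (l : ℂ) (g : ℕ → ℂ) {n q : ℕ} (hq : q < n) :
    ∑ r ∈ Finset.range n, g r * sysKernel l r q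
      = g q - (if q + 1 < n then l * g (q + 1) else 0) := by
  have h : ∀ r, g r * sysKernel l r q
      = (if r = q then g r else 0) - (if r = q + 1 then l * g r else 0) := by
    intro r
    unfold sysKernel
    split_ifs <;> first | omega | simp [mul_comm]
  simp only [h, Finset.sum_sub_distrib, Finset.sum_ite_eq', Finset.mem_range, if_pos hq]

theorem interpKernel_mul_add {m i : ℕ} (hi : i < m) (l : ℂ) (P c : ℕ) :
    interpKernel m l (m * P + i) c = if c = P then l ^ i else 0 := by
  have h : (c * m ≤ m * P + i ∧ m * P + i < c * m + m) ↔ c = P := by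
    rw [mul_comm c]
    constructor
    · rintro ⟨h1, h2⟩
      have e1 : c < P + 1 := by
        refine Nat.lt_of_mul_lt_mul_left (a := m) ?_
        rw [Nat.mul_succ]; omega
      have e2 : P < c + 1 := by
        refine Nat.lt_of_mul_lt_mul_left (a := m) ?_
        rw [Nat.mul_succ]; omega
      omega
    · rintro rfl; omega
  rw [interpKernel]
  simp only [h]
  split_ifs with h1
  · subst h1
    congr 1; rw [mul_comm c]; omega
  · rfl

theorem restKernel_succ {m j : ℕ} (hj : j < m) (l : ℂ) (c C : ℕ) :
    restKernel m l C (m * c + j + 1) = if C = c + 1 then l ^ (m - 1 - j) else 0 := by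
  have h : (m * c + j + 1 ≤ C * m ∧ C * m < m * c + j + 1 + m) ↔ C = c + 1 := by
    rw [mul_comm C]
    constructor
    · rintro ⟨h1, h2⟩
      have e1 : c < C := Nat.lt_of_mul_lt_mul_left (a := m) (by omega)
      have e2 : C < c + 2 := by
        refine Nat.lt_of_mul_lt_mul_left (a := m) ?_
        rw [Nat.mul_add, mul_two]; omega
      omega
    · rintro rfl
      rw [Nat.mul_succ]; omega
  rw [restKernel]
  simp only [h]
  split_ifs with h1
  · subst h1
    congr 1; rw [mul_comm _ m, Nat.mul_succ]; omega
  · rfl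

theorem restKernel_mul {m : ℕ} (hm : 1 ≤ m) (l : ℂ) (c C : ℕ) :
    restKernel m l C (m * c) = if C = c then 1 else 0 := by
  rcases c with _ | c
  · rw [restKernel, mul_zero]
    rcases C with _ | C
    · simp [show 0 < m by omega]
    · rw [if_neg, if_neg (by omega)]
      rw [Nat.succ_mul]; omega
  · have h := restKernel_succ (show m - 1 < m by omega) l c C
    rw [show m * c + (m - 1) + 1 = m * (c + 1) by rw [Nat.mul_succ]; omega, Nat.sub_self,
      pow_zero] at h
    exact h

theorem restKernel_eq {m : ℕ} (hm : 1 ≤ m) (l : ℂ) (C q : ℕ) :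
    restKernel m l C q
      = if C = (q + m - 1) / m then l ^ (m * ((q + m - 1) / m) - q) else 0 := by
  rcases q with _ | q
  · have h := restKernel_mul hm l 0 C
    have h' := ceil_mul hm 0
    rw [mul_zero] at h h'
    rw [h, h']; simp
  · obtain ⟨c, j, hj, rfl⟩ := exists_mul_add hm q
    rw [restKernel_succ hj, ceil_mul_add_succ hj,
      show m * (c + 1) - (m * c + j + 1) = m - 1 - j by rw [Nat.mul_succ]; omega]

theorem interpKernel_eq {m : ℕ} (hm : 1 ≤ m) (l : ℂ) (p c : ℕ) :
    interpKernel m l p c = if c = p / m then l ^ (p % m) else 0 := by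
  obtain ⟨P, i, hi, rfl⟩ := exists_mul_add hm p
  rw [interpKernel_mul_add hi, mul_add_div_self hi, mul_add_mod_self hi]

theorem injKernel_mul_add {m i : ℕ} (hi : i < m) (P c : ℕ) :
    injKernel m c (m * P + i) = if c = P then (if i = 0 then 1 else 0) else 0 := by
  have h : m * P + i = c * m ↔ c = P ∧ i = 0 := by
    constructor
    · intro h
      have h1 := congrArg (· / m) h
      have h2 := congrArg (· % m) h
      simp only [mul_add_div_self hi, mul_add_mod_self hi, Nat.mul_mod_left,
        Nat.mul_div_cancel c (show 0 < m by omega)] at h1 h2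
      exact ⟨h1.symm, h2⟩
    · rintro ⟨rfl, rfl⟩
      rw [mul_comm, add_zero]
  rw [injKernel]
  simp only [h, ite_and]

theorem one_apply_val {n : ℕ} (p q : Fin n) :
    (1 : Matrix (Fin n) (Fin n) ℂ) p q = if (p : ℕ) = q then 1 else 0 := by
  simp only [Matrix.one_apply, Fin.ext_iff]

theorem kerMat_sysKernel_mul_invKernel (n : ℕ) (l : ℂ) :
    kerMat n n (sysKernel l) * kerMat n n (invKernel l) = 1 := by
  ext p q
  rw [kerMat_mul_apply, sum_sysKernel_mul _ _ p.2, one_apply_val]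
  simp only [invKernel]
  split_ifs <;> first
    | omega
    | (rw [show (p : ℕ) - q = (p - 1 - q) + 1 by omega, pow_succ]; ring)
    | simp_all

/-! ### Identities between the matrices of two consecutive grids -/

/-- The grid with `n` time points is coarsened by the factor `m` to `n'` time points. -/
structure Coarsening (n n' m : ℕ) : Prop where
  pos : 1 ≤ m
  coarse_pos : 1 ≤ n'
  fine_eq : n = m * (n' - 1) + 1

namespace Coarsening

variable {n n' m : ℕ} (l : ℂ)

theorem div_lt (h : Coarsening n n' m) (p : Fin n) : (p : ℕ) / m < n' := by
  have h1 := h.fine_eq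
  have h2 := h.coarse_pos
  have := Nat.div_le_of_le_mul (show (p : ℕ) ≤ m * (n' - 1) by omega)
  omega

theorem ceil_lt (h : Coarsening n n' m) (p : Fin n) : ((p : ℕ) + m - 1) / m < n' := by
  have h1 := h.fine_eq
  have h2 := h.coarse_pos
  have h3 := Nat.div_le_div_right (c := m) (show (p : ℕ) + m - 1 ≤ m * (n' - 1) + m - 1 by omega)
  rw [ceil_mul h.pos] at h3
  omega

theorem mul_lt (h : Coarsening n n' m) (c : Fin n') : m * (c : ℕ) < n := by
  have h1 := h.fine_eq
  have := Nat.mul_le_mul_left m (show (c : ℕ) ≤ n' - 1 by omega)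
  omega

theorem injT_mul_apply (h : Coarsening n n' m) (g : ℕ → ℕ → ℂ) {k : ℕ} {p : Fin n} (q : Fin k)
    {P i : ℕ} (hi : i < m) (hp : (p : ℕ) = m * P + i) :
    ((kerMat n' n (injKernel m))ᵀ * kerMat n' k g) p q = if i = 0 then g P q else 0 := by
  have hP := h.div_lt p
  rw [hp, mul_add_div_self hi] at hP
  have : (kerMat n' n (injKernel m))ᵀ = kerMat n n' fun p c => injKernel m c p := rfl
  rw [this, kerMat_mul_apply]
  simp only [hp, injKernel_mul_add hi, ite_mul, zero_mul, one_mul, Finset.sum_ite_eq',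
    Finset.mem_range, if_pos hP]

/-- Interpolation steps forward exactly from every C-point, so nothing is left at F-points, and
C-points are coupled by `m` steps at once. -/
theorem sys_mul_interp (h : Coarsening n n' m) :
    kerMat n n (sysKernel l) * kerMat n n' (interpKernel m l)
      = (kerMat n' n (injKernel m))ᵀ * kerMat n' n' (sysKernel (l ^ m)) := by
  ext p c
  obtain ⟨P, i, hi, hp⟩ := exists_mul_add h.pos (p : ℕ)
  rw [kerMat_mul_apply, sum_sysKernel_mul _ _ p.2, h.injT_mul_apply _ c hi hp, hp,
    interpKernel_mul_add hi]
  rcases i with _ | i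
  · rcases P with _ | P
    · simp [sysKernel, eq_comm]
    · have e : m * (P + 1) + 0 - 1 = m * P + (m - 1) := by
        have := h.pos
        rw [Nat.mul_succ]; omega
      have hm := h.pos
      have h1 : 1 ≤ m * (P + 1) + 0 := by rw [Nat.mul_succ]; omega
      rw [e, interpKernel_mul_add (by omega), if_pos h1, if_pos rfl, sysKernel]
      have e2 : l ^ m = l * l ^ (m - 1) := by
        rw [← pow_succ']; congr 1; omega
      rw [e2]
      split_ifs <;> first | omega | simp
  · rw [show m * P + (i + 1) - 1 = m * P + i by omega, interpKernel_mul_add (by omega),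
      if_pos (show 1 ≤ m * P + (i + 1) by omega), if_neg (show ¬ i + 1 = 0 by omega)]
    split_ifs
    · ring
    · simp

theorem mul_injT_apply (h : Coarsening n n' m) (g : ℕ → ℕ → ℂ) {k : ℕ} (p : Fin k)
    (c : Fin n') :
    (kerMat k n g * (kerMat n' n (injKernel m))ᵀ) p c = g p (m * c) := by
  have : (kerMat n' n (injKernel m))ᵀ = kerMat n n' fun p c => injKernel m c p := rfl
  rw [this, kerMat_mul_apply]
  simp only [injKernel, mul_ite, mul_one, mul_zero, Finset.sum_ite_eq', Finset.mem_range,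
    mul_comm (c : ℕ) m, if_pos (h.mul_lt c)]

theorem rest_mul_injT (h : Coarsening n n' m) :
    kerMat n' n (restKernel m l) * (kerMat n' n (injKernel m))ᵀ = 1 := by
  ext C c
  rw [h.mul_injT_apply, restKernel_mul h.pos, Matrix.one_apply]
  simp only [Fin.ext_iff]

theorem inj_mul_injT (h : Coarsening n n' m) :
    kerMat n' n (injKernel m) * (kerMat n' n (injKernel m))ᵀ = 1 := by
  ext C c
  have hm := h.pos
  have h1 := injKernel_mul_add (i := 0) (by omega) c C (m := m)
  rw [h.mul_injT_apply, Matrix.one_apply]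
  rw [add_zero, if_pos rfl] at h1
  simp only [Fin.ext_iff, h1]

theorem inj_mul_interp (h : Coarsening n n' m) :
    kerMat n' n (injKernel m) * kerMat n n' (interpKernel m l) = 1 := by
  ext C c
  have hm := h.pos
  have h1 := interpKernel_mul_add (i := 0) (by omega) l C c (m := m)
  rw [add_zero, pow_zero] at h1
  rw [kerMat_mul_apply, Matrix.one_apply]
  simp only [injKernel, ite_mul, one_mul, zero_mul, Finset.sum_ite_eq', Finset.mem_range,
    mul_comm (C : ℕ) m, if_pos (h.mul_lt C), Fin.ext_iff, h1, eq_comm]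

/-- F-relaxation solves each F-interval exactly from a zero value at its left C-point. The defect
then sits at the C-points and equals the restricted right-hand side. -/
theorem sys_mul_fKernel (h : Coarsening n n' m) :
    kerMat n n (sysKernel l) * kerMat n n (fKernel m l)
      = 1 - (kerMat n' n (injKernel m))ᵀ * kerMat n' n (restKernel m l) := by
  ext p q
  have hm := h.pos
  obtain ⟨P, i, hi, hp⟩ := exists_mul_add h.pos (p : ℕ)
  rw [kerMat_mul_apply, sum_sysKernel_mul _ _ p.2, Matrix.sub_apply, one_apply_val,
    h.injT_mul_apply _ q hi hp, hp]
  -- Column 0 is the only one not of the form `m * c + j + 1`.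
  obtain hq | ⟨q', hq⟩ : (q : ℕ) = 0 ∨ ∃ q', (q : ℕ) = q' + 1 := by
    rcases (q : ℕ) with _ | q'
    · exact .inl rfl
    · exact .inr ⟨q', rfl⟩
  · have h0 : (q : ℕ) = m * 0 := by omega
    rw [h0, fKernel_mul hm, fKernel_mul hm, restKernel_mul hm, mul_zero, mul_zero]
    have h1 : m * P + i = 0 ↔ i = 0 ∧ P = 0 := by
      constructor
      · intro h
        have := Nat.eq_zero_of_add_eq_zero h
        refine ⟨this.2, ?_⟩
        rcases Nat.mul_eq_zero.1 this.1 with h | h <;> omega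
      · rintro ⟨rfl, rfl⟩; rfl
    simp only [h1, ite_and]
    simp
  · obtain ⟨c, j, hj, rfl⟩ := exists_mul_add hm q'
    rw [hq, fKernel_succ hi hj, restKernel_succ hj]
    rcases i with _ | i
    · have hd : (m * P + 0 = m * c + j + 1) ↔ (P = c + 1 ∧ j = m - 1) := by
        constructor
        · intro h1
          have h2 := congrArg (fun x => (x + m - 1) / m) h1
          simp only [add_zero, ceil_mul hm, ceil_mul_add_succ hj] at h2
          subst h2
          rw [Nat.mul_succ] at h1
          omega
        · rintro ⟨rfl, rfl⟩
          rw [Nat.mul_succ]; omega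
      rw [if_neg (by omega), if_pos rfl]
      simp only [hd]
      rcases P with _ | P
      · simp
      · have e : m * (P + 1) + 0 - 1 = m * P + (m - 1) := by
          rw [Nat.mul_succ]; omega
        rw [e, fKernel_succ (by omega) hj, if_pos (by rw [Nat.mul_succ]; omega)]
        by_cases hPc : P = c
        · subst hPc
          by_cases hjm : j = m - 1
          · simp [hjm]
          · rw [if_pos ⟨rfl, by omega⟩, if_neg (by omega), if_pos rfl,
              show m - 1 - j = (m - 1 - j - 1) + 1 by omega, pow_succ, Nat.add_sub_cancel]
            ring
        · rw [if_neg (by omega), if_neg (by omega), if_neg (by omega)]; simp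
    · have hd : (m * P + (i + 1) = m * c + j + 1) ↔ (P = c ∧ j = i) := by
        constructor
        · intro h1
          have h1 : m * P + i = m * c + j := by omega
          have h2 := congrArg (· / m) h1
          have h3 := congrArg (· % m) h1
          simp only [mul_add_div_self hj, mul_add_mod_self hj,
            mul_add_div_self (show i < m by omega), mul_add_mod_self (show i < m by omega)] at h2 h3
          exact ⟨h2, h3.symm⟩
        · rintro ⟨rfl, rfl⟩; rfl
      simp only [hd]
      rw [show m * P + (i + 1) - 1 = m * P + i by omega, fKernel_succ (by omega) hj,
        if_pos (show 1 ≤ m * P + (i + 1) by omega), if_neg (show ¬ i + 1 = 0 by omega)]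
      by_cases hPc : P = c
      · subst hPc
        rcases lt_trichotomy j i with hji | rfl | hji
        · rw [if_pos ⟨rfl, by omega⟩, if_pos ⟨rfl, hji⟩, if_neg (by omega),
            show i + 1 - j - 1 = (i - j - 1) + 1 by omega, pow_succ]
          ring
        · simp
        · rw [if_neg (by omega), if_neg (by omega), if_neg (by omega)]; simp
      · rw [if_neg (by tauto), if_neg (by tauto), if_neg (by tauto)]; simp

/-- Interpolation has one nonzero entry per row (at the floor) and restriction one per column (at
the ceiling), so both sums collapse. -/
theorem fKernel_add_interp_mul_rest (h : Coarsening n n' m) (κ : ℕ → ℕ → ℂ) :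
    kerMat n n (fKernel m l)
        + kerMat n n' (interpKernel m l) * kerMat n' n' κ * kerMat n' n (restKernel m l)
      = kerMat n n (cycleKernel m l κ) := by
  ext p q
  have e : kerMat n n' (interpKernel m l) * kerMat n' n' κ
      = kerMat n n' fun p c => l ^ (p % m) * κ (p / m) c := by
    ext p c
    rw [kerMat_mul_apply, kerMat_apply]
    simp only [interpKernel_eq h.pos, ite_mul, zero_mul, Finset.sum_ite_eq', Finset.mem_range,
      if_pos (h.div_lt p)]
  rw [e, Matrix.add_apply, kerMat_mul_apply, kerMat_apply, kerMat_apply, cycleKernel]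
  simp only [restKernel_eq h.pos, mul_ite, mul_zero, Finset.sum_ite_eq', Finset.mem_range,
    if_pos (h.ceil_lt q)]

end Coarsening

/-! ### The F-point embedding and the inverse of the F-point block -/

theorem fEmb_transpose_mul_fEmb (n m : ℕ) : (fEmb n m)ᵀ * fEmb n m = 1 := by
  ext p q
  simp [Matrix.mul_apply, fEmb, Matrix.one_apply, Subtype.ext_iff, eq_comm]

theorem fEmb_mul_transpose (n m : ℕ) :
    fEmb n m * (fEmb n m)ᵀ = Matrix.diagonal fun p : Fin n => if m ∣ (p : ℕ) then 0 else 1 := by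
  ext p q
  rw [Matrix.mul_apply, Matrix.diagonal_apply]
  by_cases hp : m ∣ (p : ℕ)
  · rw [if_pos hp, ite_self]
    refine Finset.sum_eq_zero fun r _ => ?_
    rw [fEmb, Matrix.of_apply, if_neg, zero_mul]
    rintro rfl
    exact r.2 hp
  · rw [Finset.sum_eq_single_of_mem ⟨p, hp⟩ (Finset.mem_univ _)]
    · simp [fEmb, hp, eq_comm]
    · rintro r - hr
      rw [fEmb, Matrix.of_apply, if_neg, zero_mul]
      rintro rfl
      exact hr rfl

theorem fEmb_mul_transpose_mul_fKernel {n m : ℕ} (hm : 1 ≤ m) (l : ℂ) :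
    fEmb n m * (fEmb n m)ᵀ * kerMat n n (fKernel m l) = kerMat n n (fKernel m l) := by
  ext p q
  rw [fEmb_mul_transpose, Matrix.diagonal_mul, kerMat_apply]
  split_ifs with h
  · obtain ⟨c, hc⟩ := h
    rw [fKernel, if_neg, zero_mul]
    rintro ⟨h1, h2⟩
    have h3 := Nat.div_le_div_right (c := m) (show (q : ℕ) + m - 1 ≤ p + m - 1 by omega)
    rw [hc, ceil_mul hm] at h3
    have := Nat.mul_le_mul_left m h3
    omega
  · rw [one_mul]

theorem fKernel_mul_fEmb_mul_transpose {n m : ℕ} (hm : 1 ≤ m) (l : ℂ) :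
    kerMat n n (fKernel m l) * (fEmb n m * (fEmb n m)ᵀ) = kerMat n n (fKernel m l) := by
  ext p q
  rw [fEmb_mul_transpose, Matrix.mul_diagonal, kerMat_apply]
  split_ifs with h
  · obtain ⟨c, hc⟩ := h
    rw [hc, fKernel_mul hm, zero_mul]
  · rw [mul_one]

theorem injKernel_mul_fEmb (n n' m : ℕ) : kerMat n' n (injKernel m) * fEmb n m = 0 := by
  ext c q
  rw [Matrix.mul_apply]
  refine Finset.sum_eq_zero fun p _ => ?_
  rw [kerMat_apply, injKernel, fEmb, Matrix.of_apply]
  split_ifs with h1 h2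
  · subst h2
    exact absurd (Dvd.intro_left _ h1.symm) q.2
  all_goals simp

/-- The F-kernel has no rows at C-points, so S Sᵀ in the middle may be dropped; the defect left by
`sys_mul_fKernel` lives on C-points and is killed by Sᵀ. -/
theorem Coarsening.fEmb_sys_mul_fKernel {n n' m : ℕ} (h : Coarsening n n' m) (l : ℂ) :
    ((fEmb n m)ᵀ * kerMat n n (sysKernel l) * fEmb n m)
      * ((fEmb n m)ᵀ * kerMat n n (fKernel m l) * fEmb n m) = 1 := by
  have h0 : (fEmb n m)ᵀ * (kerMat n' n (injKernel m))ᵀ = 0 := by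
    rw [← Matrix.transpose_mul, injKernel_mul_fEmb, Matrix.transpose_zero]
  calc _ = (fEmb n m)ᵀ * (kerMat n n (sysKernel l)
          * (fEmb n m * (fEmb n m)ᵀ * kerMat n n (fKernel m l))) * fEmb n m := by
        simp only [Matrix.mul_assoc]
    _ = 1 := by
        rw [fEmb_mul_transpose_mul_fKernel h.pos, h.sys_mul_fKernel, Matrix.mul_sub,
          ← Matrix.mul_assoc (fEmb n m)ᵀ, h0, Matrix.zero_mul, sub_zero, Matrix.mul_one,
          fEmb_transpose_mul_fEmb]

theorem fEmb_mul_fKernel_mul_transpose {n m : ℕ} (hm : 1 ≤ m) (l : ℂ) :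
    fEmb n m * ((fEmb n m)ᵀ * kerMat n n (fKernel m l) * fEmb n m) * (fEmb n m)ᵀ
      = kerMat n n (fKernel m l) := by
  calc _ = fEmb n m * (fEmb n m)ᵀ * kerMat n n (fKernel m l) * (fEmb n m * (fEmb n m)ᵀ) := by
        simp only [Matrix.mul_assoc]
    _ = _ := by rw [fEmb_mul_transpose_mul_fKernel hm, fKernel_mul_fEmb_mul_transpose hm]

theorem one_sub_mul_sysKernel (n : ℕ) {κ : ℕ → ℕ → ℂ} (hκ : UnitLower κ) (μ : ℂ) :
    1 - kerMat n n κ * kerMat n n (sysKernel μ) = kerMat n n (errKernel μ κ) := by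
  ext p q
  rw [Matrix.sub_apply, kerMat_mul_apply, sum_mul_sysKernel _ _ q.2, one_apply_val,
    kerMat_apply, errKernel]
  -- The cutoff at the last column is harmless, since a column outside the grid vanishes by
  -- triangularity.
  have h1 : (if (q : ℕ) + 1 < n then μ * κ p (q + 1) else 0) = μ * κ p (q + 1) := by
    split_ifs with h
    · rfl
    · rw [hκ.lower (by omega), mul_zero]
  rw [h1]
  rcases lt_trichotomy (p : ℕ) q with h | h | h
  · rw [if_neg (by omega), if_neg (by omega), hκ.lower h, hκ.lower (by omega)]; simp
  · rw [if_pos h, if_neg (by omega), h, hκ.diag, hκ.lower (by omega)]; simp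
  · rw [if_neg (by omega), if_pos h]; ring

/-- Reversal of time turns a persymmetric approximate inverse applied from the right into the
transpose of its application from the left. -/
theorem one_sub_sysKernel_mul_rev {n : ℕ} {κ : ℕ → ℕ → ℂ}
    (hκ : ∀ p q : Fin n, κ q.rev p.rev = κ p q) (μ : ℂ) (p q : Fin n) :
    (1 - kerMat n n (sysKernel μ) * kerMat n n κ) q.rev p.rev
      = (1 - kerMat n n κ * kerMat n n (sysKernel μ)) p q := by
  have hs : ∀ p q : Fin n, sysKernel μ q.rev p.rev = sysKernel μ p q := by
    intro p q
    simp only [sysKernel, Fin.val_rev]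
    have h1 : n - (q + 1) = n - ((p : ℕ) + 1) ↔ (p : ℕ) = q := by omega
    have h2 : n - ((q : ℕ) + 1) = n - (p + 1) + 1 ↔ (p : ℕ) = q + 1 := by omega
    simp only [h1, h2]
  rw [Matrix.sub_apply, Matrix.sub_apply, Matrix.mul_apply, Matrix.mul_apply]
  congr 1
  · simp only [Matrix.one_apply, Fin.rev_inj, eq_comm]
  · rw [← Equiv.sum_comp Fin.revPerm]
    refine Finset.sum_congr rfl fun r _ => ?_
    simp only [Fin.revPerm_apply, kerMat_apply, hs, hκ]
    ring

/-! ### Matrices that are diagonalized by a common unitary matrix -/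

open scoped Kronecker in
/-- The space-time matrix whose spatial mode `k` (a column of `X`) evolves by `f k`. -/
def modal {Nx : ℕ} {ι κ : Type*} [Fintype ι] [Fintype κ] [DecidableEq ι] [DecidableEq κ]
    (X : SpaceOp Nx) (f : Fin Nx → Matrix ι κ ℂ) : Matrix (ι × Fin Nx) (κ × Fin Nx) ℂ :=
  ((1 : Matrix ι ι ℂ) ⊗ₖ X) * Matrix.blockDiagonal f * ((1 : Matrix κ κ ℂ) ⊗ₖ Xᴴ)

section Modal

variable {Nx : ℕ} {ι κ τ : Type*} [Fintype ι] [Fintype κ] [Fintype τ]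
  [DecidableEq ι] [DecidableEq κ] [DecidableEq τ] {X : SpaceOp Nx}

theorem modal_apply (X : SpaceOp Nx) (f : Fin Nx → Matrix ι κ ℂ) (p : ι × Fin Nx)
    (q : κ × Fin Nx) :
    modal X f p q = (X * Matrix.diagonal (fun k => f k p.1 q.1) * Xᴴ) p.2 q.2 := by
  simp [modal, Matrix.mul_apply, Fintype.sum_prod_type, Matrix.kroneckerMap_apply,
    Matrix.one_apply, Matrix.blockDiagonal_apply, Matrix.diagonal_apply]

open scoped Kronecker in
theorem one_kronecker_mul {Y Z : SpaceOp Nx} (h : Y * Z = 1) :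
    ((1 : Matrix ι ι ℂ) ⊗ₖ Y) * ((1 : Matrix ι ι ℂ) ⊗ₖ Z) = 1 := by
  rw [← Matrix.mul_kronecker_mul, h, Matrix.one_mul, Matrix.one_kronecker_one]

theorem modal_mul (hX : Xᴴ * X = 1) (f : Fin Nx → Matrix ι κ ℂ) (g : Fin Nx → Matrix κ τ ℂ) :
    modal X f * modal X g = modal X fun k => f k * g k := by
  rw [modal, modal, modal, Matrix.blockDiagonal_mul]
  simp only [Matrix.mul_assoc]
  rw [← Matrix.mul_assoc _ _ (Matrix.blockDiagonal g * _), one_kronecker_mul hX, Matrix.one_mul]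

theorem modal_one (hX : X * Xᴴ = 1) : modal X (fun _ => (1 : Matrix ι ι ℂ)) = 1 := by
  have h : Matrix.blockDiagonal (fun _ : Fin Nx => (1 : Matrix ι ι ℂ)) = 1 :=
    Matrix.blockDiagonal_one
  rw [modal, h, Matrix.mul_one, one_kronecker_mul hX]

theorem modal_add (f g : Fin Nx → Matrix ι κ ℂ) :
    modal X f + modal X g = modal X fun k => f k + g k := by
  have h : Matrix.blockDiagonal (fun k => f k + g k) = _ := Matrix.blockDiagonal_add f g
  rw [modal, modal, modal, h, Matrix.mul_add, Matrix.add_mul]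

theorem modal_sub (f g : Fin Nx → Matrix ι κ ℂ) :
    modal X f - modal X g = modal X fun k => f k - g k := by
  have h : Matrix.blockDiagonal (fun k => f k - g k) = _ := Matrix.blockDiagonal_sub f g
  rw [modal, modal, modal, h, Matrix.mul_sub, Matrix.sub_mul]

theorem modal_inv (hX : Xᴴ * X = 1) (hX' : X * Xᴴ = 1) {f g : Fin Nx → Matrix ι ι ℂ}
    (h : ∀ k, f k * g k = 1) : (modal X f)⁻¹ = modal X g := by
  refine Matrix.inv_eq_right_inv ?_
  rw [modal_mul hX]
  simp only [h]
  exact modal_one hX'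

theorem modal_one_left (f : Fin Nx → Matrix ι κ ℂ) : modal 1 f = Matrix.blockDiagonal f := by
  rw [modal, Matrix.conjTranspose_one, Matrix.one_kronecker_one, Matrix.one_kronecker_one,
    Matrix.one_mul, Matrix.mul_one]

theorem conj_diagonal_pow (hX : Xᴴ * X = 1) (hX' : X * Xᴴ = 1) (z : Fin Nx → ℂ) (j : ℕ) :
    (X * Matrix.diagonal z * Xᴴ) ^ j = X * Matrix.diagonal (fun k => z k ^ j) * Xᴴ := by
  induction j with
  | zero => simp [hX']
  | succ j ih =>
    rw [pow_succ, ih]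
    calc _ = X * Matrix.diagonal (fun k => z k ^ j) * (Xᴴ * X) * Matrix.diagonal z * Xᴴ := by
          simp only [Matrix.mul_assoc]
      _ = X * (Matrix.diagonal (fun k => z k ^ j) * Matrix.diagonal z) * Xᴴ := by
          rw [hX, Matrix.mul_one, Matrix.mul_assoc X]
      _ = _ := by simp only [Matrix.diagonal_mul_diagonal, pow_succ]

theorem systemMatrix_eq_modal (hX' : X * Xᴴ = 1) (n : ℕ) (z : Fin Nx → ℂ) :
    systemMatrix n (X * Matrix.diagonal z * Xᴴ) = modal X fun k => kerMat n n (sysKernel (z k)) := by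
  ext p q
  rw [modal_apply, systemMatrix, Matrix.of_apply]
  simp only [kerMat_apply, sysKernel]
  split_ifs
  · simp [hX']
  · rw [← Matrix.diagonal_neg, Matrix.mul_neg, Matrix.neg_mul, Matrix.neg_apply]
  · simp

theorem interpolation_eq_modal (hX : Xᴴ * X = 1) (hX' : X * Xᴴ = 1) (n n' m : ℕ)
    (z : Fin Nx → ℂ) :
    interpolation n n' m (X * Matrix.diagonal z * Xᴴ)
      = modal X fun k => kerMat n n' (interpKernel m (z k)) := by
  ext p q
  rw [modal_apply, interpolation, Matrix.of_apply]
  simp only [kerMat_apply, interpKernel]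
  split_ifs
  · rw [conj_diagonal_pow hX hX']
  · simp

theorem restriction_eq_modal (hX : Xᴴ * X = 1) (hX' : X * Xᴴ = 1) (n n' m : ℕ)
    (z : Fin Nx → ℂ) :
    restriction n n' m (X * Matrix.diagonal z * Xᴴ)
      = modal X fun k => kerMat n' n (restKernel m (z k)) := by
  ext p q
  rw [modal_apply, restriction, Matrix.of_apply]
  simp only [kerMat_apply, restKernel]
  split_ifs
  · rw [conj_diagonal_pow hX hX']
  · simp

theorem injection_eq_modal (hX' : X * Xᴴ = 1) (n n' m : ℕ) :
    injection Nx n n' m = modal X fun _ => kerMat n' n (injKernel m) := by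
  ext p q
  rw [modal_apply, injection, Matrix.of_apply]
  simp only [kerMat_apply, injKernel]
  split_ifs
  · simp [hX']
  · simp

theorem injection_transpose_eq_modal (hX' : X * Xᴴ = 1) (n n' m : ℕ) :
    (injection Nx n n' m)ᵀ = modal X fun _ => (kerMat n' n (injKernel m))ᵀ := by
  ext p q
  rw [modal_apply, injection, Matrix.transpose_apply, Matrix.of_apply]
  simp only [Matrix.transpose_apply, kerMat_apply, injKernel]
  split_ifs
  · simp [hX', Matrix.one_apply, eq_comm]
  · simp

theorem fEmbedding_eq_modal (hX' : X * Xᴴ = 1) (n m : ℕ) :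
    fEmbedding Nx n m = modal X fun _ => fEmb n m := by
  ext p q
  rw [modal_apply, fEmbedding, Matrix.of_apply]
  simp only [fEmb, Matrix.of_apply]
  split_ifs
  · simp [hX']
  · simp

theorem fEmbedding_transpose_eq_modal (hX' : X * Xᴴ = 1) (n m : ℕ) :
    (fEmbedding Nx n m)ᵀ = modal X fun _ => (fEmb n m)ᵀ := by
  ext p q
  rw [modal_apply, fEmbedding, Matrix.transpose_apply, Matrix.of_apply]
  simp only [fEmb, Matrix.transpose_apply, Matrix.of_apply]
  split_ifs
  · simp [hX', Matrix.one_apply, eq_comm]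
  · simp

theorem fSolve_eq_modal (hX : Xᴴ * X = 1) (hX' : X * Xᴴ = 1) {n n' m : ℕ}
    (h : Coarsening n n' m) (z : Fin Nx → ℂ) :
    fSolve n m (X * Matrix.diagonal z * Xᴴ) = modal X fun k => kerMat n n (fKernel m (z k)) := by
  rw [fSolve, fEmbedding_transpose_eq_modal hX', fEmbedding_eq_modal hX',
    systemMatrix_eq_modal hX', modal_mul hX, modal_mul hX,
    modal_inv hX hX' fun k => h.fEmb_sys_mul_fKernel (z k), modal_mul hX, modal_mul hX]
  simp only [fEmb_mul_fKernel_mul_transpose h.pos]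

theorem absRowSum_modal_one (f : Fin Nx → Matrix ι κ ℂ) (p : ι) (k : Fin Nx) :
    absRowSum (modal 1 f) (p, k) = ∑ q, ‖f k p q‖ := by
  rw [absRowSum, modal_one_left, Fintype.sum_prod_type]
  refine Finset.sum_congr rfl fun q _ => ?_
  rw [Finset.sum_eq_single_of_mem k (Finset.mem_univ _), Matrix.blockDiagonal_apply_eq]
  intro k' _ hk
  rw [Matrix.blockDiagonal_apply_ne _ _ _ hk.symm, norm_zero]

theorem absColSum_modal_one (f : Fin Nx → Matrix ι κ ℂ) (q : κ) (k : Fin Nx) :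
    absColSum (modal 1 f) (q, k) = ∑ p, ‖f k p q‖ := by
  rw [absColSum, modal_one_left, Fintype.sum_prod_type]
  refine Finset.sum_congr rfl fun p _ => ?_
  rw [Finset.sum_eq_single_of_mem k (Finset.mem_univ _), Matrix.blockDiagonal_apply_eq]
  intro k' _ hk
  rw [Matrix.blockDiagonal_apply_ne _ _ _ hk, norm_zero]

end Modal

/-! ### Euclidean norms -/

theorem norm2_mulVec_of_isometry {n n' Nx : ℕ} {M : STMat n n' Nx} (hM : Mᴴ * M = 1)
    (v : STVec n' Nx) : norm2 (M *ᵥ v) = norm2 v := by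
  have key : ∀ {n : ℕ} (v : STVec n Nx), ((∑ p, ‖v p‖ ^ 2 : ℝ) : ℂ) = star v ⬝ᵥ v := by
    intro n v
    rw [dotProduct]
    push_cast
    refine Finset.sum_congr rfl fun p _ => ?_
    exact (Complex.conj_mul' (v p)).symm
  have h : (∑ p, ‖(M *ᵥ v) p‖ ^ 2 : ℝ) = ∑ p, ‖v p‖ ^ 2 := by
    apply Complex.ofReal_injective
    rw [key, key, Matrix.star_mulVec, ← Matrix.dotProduct_mulVec, Matrix.mulVec_mulVec, hM,
      Matrix.one_mulVec]
  rw [norm2, norm2, h]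

/-- The Schur test. -/
theorem norm2_mulVec_le {n n' Nx : ℕ} (M : STMat n n' Nx) {r c : ℝ} (hr0 : 0 ≤ r)
    (hr : ∀ p, absRowSum M p ≤ r) (hc : ∀ q, absColSum M q ≤ c) (v : STVec n' Nx) :
    norm2 (M *ᵥ v) ≤ √(c * r) * norm2 v := by
  have h1 : ∀ p, ‖(M *ᵥ v) p‖ ^ 2 ≤ r * ∑ q, ‖M p q‖ * ‖v q‖ ^ 2 := by
    intro p
    have h2 : ‖(M *ᵥ v) p‖ ≤ ∑ q, ‖M p q‖ * ‖v q‖ := by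
      rw [Matrix.mulVec, dotProduct]
      exact (norm_sum_le _ _).trans_eq (by simp only [norm_mul])
    calc ‖(M *ᵥ v) p‖ ^ 2 ≤ (∑ q, ‖M p q‖ * ‖v q‖) ^ 2 := by gcongr
      -- Cauchy–Schwarz, splitting `‖M p q‖` evenly between the two factors.
      _ ≤ (∑ q, ‖M p q‖) * ∑ q, ‖M p q‖ * ‖v q‖ ^ 2 :=
        Finset.sum_sq_le_sum_mul_sum_of_sq_le_mul _ (fun _ _ => by positivity)
          (fun _ _ => by positivity) (fun _ _ => le_of_eq (by ring))
      _ ≤ r * ∑ q, ‖M p q‖ * ‖v q‖ ^ 2 := by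
        gcongr
        exact hr p
  have h3 : ∑ p, ‖(M *ᵥ v) p‖ ^ 2 ≤ c * r * ∑ q, ‖v q‖ ^ 2 := by
    calc ∑ p, ‖(M *ᵥ v) p‖ ^ 2 ≤ ∑ p, r * ∑ q, ‖M p q‖ * ‖v q‖ ^ 2 :=
          Finset.sum_le_sum fun p _ => h1 p
      _ = r * ∑ q, absColSum M q * ‖v q‖ ^ 2 := by
          rw [← Finset.mul_sum, Finset.sum_comm]
          simp only [absColSum, Finset.sum_mul]
      _ ≤ r * ∑ q, c * ‖v q‖ ^ 2 := by
          gcongr with q _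
          exact hc q
      _ = c * r * ∑ q, ‖v q‖ ^ 2 := by rw [← Finset.mul_sum]; ring
  rw [norm2, norm2, ← Real.sqrt_mul' _ (by positivity)]
  exact Real.sqrt_le_sqrt h3

theorem norm2_modal_mulVec_le {n n' Nx : ℕ} {X : SpaceOp Nx} (hX : Xᴴ * X = 1) (hX' : X * Xᴴ = 1)
    (f : Fin Nx → Matrix (Fin n) (Fin n') ℂ) {r c : ℝ} (hr0 : 0 ≤ r)
    (hr : ∀ k p, ∑ q, ‖f k p q‖ ≤ r) (hc : ∀ k q, ∑ p, ‖f k p q‖ ≤ c) (v : STVec n' Nx) :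
    norm2 (modal X f *ᵥ v) ≤ √(c * r) * norm2 v := by
  rw [modal, ← Matrix.mulVec_mulVec, ← Matrix.mulVec_mulVec, norm2_mulVec_of_isometry]
  · refine (norm2_mulVec_le (c := c) _ hr0 ?_ ?_ _).trans_eq ?_
    · rintro ⟨p, k⟩
      rw [← modal_one_left, absRowSum_modal_one]
      exact hr k p
    · rintro ⟨q, k⟩
      rw [← modal_one_left, absColSum_modal_one]
      exact hc k q
    · rw [norm2_mulVec_of_isometry]
      rw [Matrix.conjTranspose_kronecker, Matrix.conjTranspose_one, Matrix.conjTranspose_conjTranspose,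
        one_kronecker_mul hX']
  · rw [Matrix.conjTranspose_kronecker, Matrix.conjTranspose_one, one_kronecker_mul hX]

theorem norm2_injection_transpose_mulVec {n n' m Nx : ℕ} (h : Coarsening n n' m)
    (v : STVec n' Nx) : norm2 ((injection Nx n n' m)ᵀ *ᵥ v) = norm2 v := by
  have hX : (1 : SpaceOp Nx) * (1 : SpaceOp Nx)ᴴ = 1 := by simp
  have hX' : (1 : SpaceOp Nx)ᴴ * (1 : SpaceOp Nx) = 1 := by simp
  have hs : (injection Nx n n' m)ᵀᴴ = injection Nx n n' m := by
    ext p q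
    simp only [Matrix.conjTranspose_apply, Matrix.transpose_apply, injection, Matrix.of_apply,
      Matrix.one_apply]
    split_ifs <;> simp
  refine norm2_mulVec_of_isometry ?_ v
  rw [hs, injection_transpose_eq_modal hX, injection_eq_modal hX, modal_mul hX', h.inj_mul_injT,
    modal_one hX]

/-! ### Extremal row and column sums of shift invariant kernels -/

section Shift

variable {f : ℕ → ℕ → ℂ} {M n : ℕ}

/-- Shifting a column inserts `M` zeros at the top and pushes `M` entries out at the bottom. -/
theorem sum_col_shift_le (hlow : ∀ p q, p ≤ q → f p q = 0)
    (hshift : ∀ p q, f (p + M) (q + M) = f p q) (q s : ℕ) :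
    ∑ p ∈ Finset.range n, ‖f p (q + M * s)‖ ≤ ∑ p ∈ Finset.range n, ‖f p q‖ := by
  induction s with
  | zero => simp
  | succ s ih =>
    refine le_trans ?_ ih
    rw [Nat.mul_succ, ← add_assoc]
    generalize q + M * s = q
    rcases le_total n M with h | h
    · rw [Finset.sum_eq_zero]
      · positivity
      · intro p hp
        have := Finset.mem_range.1 hp
        rw [hlow _ _ (by omega), norm_zero]
    · obtain ⟨d, rfl⟩ := Nat.exists_eq_add_of_le h
      rw [Finset.sum_range_add, Finset.sum_eq_zero (s := Finset.range M), zero_add]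
      · simp only [add_comm M, hshift]
        exact Finset.sum_le_sum_of_subset_of_nonneg
          (Finset.range_subset_range.2 (by omega)) fun _ _ _ => norm_nonneg _
      · intro p hp
        have := Finset.mem_range.1 hp
        rw [hlow _ _ (by omega), norm_zero]

/-- Shifting a row pushes out only entries right of the diagonal, which are zero, and brings in new
ones on the left. -/
theorem sum_row_le_shift (hlow : ∀ p q, p ≤ q → f p q = 0)
    (hshift : ∀ p q, f (p + M) (q + M) = f p q) {p s : ℕ} (hp : p + M * s < n) :
    ∑ q ∈ Finset.range n, ‖f p q‖ ≤ ∑ q ∈ Finset.range n, ‖f (p + M * s) q‖ := by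
  induction s with
  | zero => simp
  | succ s ih =>
    rw [Nat.mul_succ, ← add_assoc] at *
    refine le_trans (ih (by omega)) ?_
    generalize p + M * s = p at *
    obtain ⟨d, rfl⟩ := Nat.exists_eq_add_of_le (show M ≤ n by omega)
    conv_rhs => rw [Finset.sum_range_add]
    rw [add_comm M d, Finset.sum_range_add, Finset.sum_eq_zero (s := Finset.range M), add_zero]
    · refine le_add_of_nonneg_of_le (by positivity) (le_of_eq ?_)
      simp only [add_comm M, hshift]
    · intro q _
      rw [hlow _ _ (by omega), norm_zero]

end Shift

/-! ### The matrices of the hierarchy in the common eigenbasis -/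

/-- A hierarchy of four grids whose time-stepping operators are diagonalized by the unitary
matrix `X`. -/
structure DiagHierarchy {Nx : ℕ} (m N : ℕ → ℕ) (Φ : ℕ → SpaceOp Nx) (X : SpaceOp Nx)
    (lam : ℕ → Fin Nx → ℂ) : Prop where
  star_mul : Xᴴ * X = 1
  mul_star : X * Xᴴ = 1
  coarsening : ∀ ℓ < 3, Coarsening (N ℓ) (N (ℓ + 1)) (m ℓ)
  eq_conj : ∀ ℓ < 4, Φ ℓ = X * Matrix.diagonal (lam ℓ) * Xᴴ

namespace DiagHierarchy

variable {Nx : ℕ} {m N : ℕ → ℕ} {Φ : ℕ → SpaceOp Nx} {X : SpaceOp Nx} {lam : ℕ → Fin Nx → ℂ}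

theorem Amat_eq (h : DiagHierarchy m N Φ X lam) {ℓ : ℕ} (hℓ : ℓ < 4) :
    Amat N Φ ℓ = modal X fun k => kerMat (N ℓ) (N ℓ) (sysKernel (lam ℓ k)) := by
  rw [Amat, h.eq_conj ℓ hℓ, systemMatrix_eq_modal h.mul_star]

theorem Amat_inv_eq (h : DiagHierarchy m N Φ X lam) {ℓ : ℕ} (hℓ : ℓ < 4) :
    (Amat N Φ ℓ)⁻¹ = modal X fun k => kerMat (N ℓ) (N ℓ) (invKernel (lam ℓ k)) := by
  rw [h.Amat_eq hℓ]
  exact modal_inv h.star_mul h.mul_star fun k => kerMat_sysKernel_mul_invKernel _ _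

theorem Pmat_eq (h : DiagHierarchy m N Φ X lam) {ℓ : ℕ} (hℓ : ℓ < 4) :
    Pmat m N Φ ℓ = modal X fun k => kerMat (N ℓ) (N (ℓ + 1)) (interpKernel (m ℓ) (lam ℓ k)) := by
  rw [Pmat, h.eq_conj ℓ hℓ, interpolation_eq_modal h.star_mul h.mul_star]

theorem Rmat_eq (h : DiagHierarchy m N Φ X lam) {ℓ : ℕ} (hℓ : ℓ < 4) :
    Rmat m N Φ ℓ = modal X fun k => kerMat (N (ℓ + 1)) (N ℓ) (restKernel (m ℓ) (lam ℓ k)) := by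
  rw [Rmat, h.eq_conj ℓ hℓ, restriction_eq_modal h.star_mul h.mul_star]

theorem RImat_eq (h : DiagHierarchy m N Φ X lam) (ℓ : ℕ) :
    RImat Nx m N ℓ = modal X fun _ => kerMat (N (ℓ + 1)) (N ℓ) (injKernel (m ℓ)) := by
  rw [RImat, injection_eq_modal h.mul_star]

theorem RImat_transpose_eq (h : DiagHierarchy m N Φ X lam) (ℓ : ℕ) :
    (RImat Nx m N ℓ)ᵀ = modal X fun _ => (kerMat (N (ℓ + 1)) (N ℓ) (injKernel (m ℓ)))ᵀ := by
  rw [RImat, injection_transpose_eq_modal h.mul_star]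

theorem Fmat_eq (h : DiagHierarchy m N Φ X lam) {ℓ : ℕ} (hℓ : ℓ < 3) :
    Fmat m N Φ ℓ = modal X fun k => kerMat (N ℓ) (N ℓ) (fKernel (m ℓ) (lam ℓ k)) := by
  rw [Fmat, h.eq_conj ℓ (by omega), fSolve_eq_modal h.star_mul h.mul_star (h.coarsening ℓ hℓ)]

theorem Amat_mul_Pmat (h : DiagHierarchy m N Φ X lam) {ℓ : ℕ} (hℓ : ℓ < 3) :
    Amat N Φ ℓ * Pmat m N Φ ℓ = (RImat Nx m N ℓ)ᵀ *
      modal X fun k => kerMat (N (ℓ + 1)) (N (ℓ + 1)) (sysKernel (lam ℓ k ^ m ℓ)) := by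
  rw [h.Amat_eq (by omega), h.Pmat_eq (by omega), h.RImat_transpose_eq, modal_mul h.star_mul,
    modal_mul h.star_mul]
  simp only [(h.coarsening ℓ hℓ).sys_mul_interp]

theorem Rmat_mul_RImat_transpose (h : DiagHierarchy m N Φ X lam) {ℓ : ℕ} (hℓ : ℓ < 3) :
    Rmat m N Φ ℓ * (RImat Nx m N ℓ)ᵀ = 1 := by
  rw [h.Rmat_eq (by omega), h.RImat_transpose_eq, modal_mul h.star_mul]
  simp only [(h.coarsening ℓ hℓ).rest_mul_injT]
  exact modal_one h.mul_star

theorem RImat_mul_Pmat (h : DiagHierarchy m N Φ X lam) {ℓ : ℕ} (hℓ : ℓ < 3) :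
    RImat Nx m N ℓ * Pmat m N Φ ℓ = 1 := by
  rw [h.RImat_eq, h.Pmat_eq (by omega), modal_mul h.star_mul]
  simp only [(h.coarsening ℓ hℓ).inj_mul_interp]
  exact modal_one h.mul_star

theorem Amat_mul_Fmat (h : DiagHierarchy m N Φ X lam) {ℓ : ℕ} (hℓ : ℓ < 3) :
    Amat N Φ ℓ * Fmat m N Φ ℓ = 1 - (RImat Nx m N ℓ)ᵀ * Rmat m N Φ ℓ := by
  rw [h.Amat_eq (by omega), h.Fmat_eq hℓ, h.RImat_transpose_eq, h.Rmat_eq (by omega),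
    modal_mul h.star_mul, modal_mul h.star_mul, ← modal_one h.mul_star, modal_sub]
  simp only [(h.coarsening ℓ hℓ).sys_mul_fKernel]

theorem Fmat_add_Pmat_mul_Rmat (h : DiagHierarchy m N Φ X lam) {ℓ : ℕ} (hℓ : ℓ < 3)
    (κ : Fin Nx → ℕ → ℕ → ℂ) :
    Fmat m N Φ ℓ + Pmat m N Φ ℓ * (modal X fun k => kerMat (N (ℓ + 1)) (N (ℓ + 1)) (κ k))
        * Rmat m N Φ ℓ
      = modal X fun k => kerMat (N ℓ) (N ℓ) (cycleKernel (m ℓ) (lam ℓ k) (κ k)) := by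
  rw [h.Fmat_eq hℓ, h.Pmat_eq (by omega), h.Rmat_eq (by omega), modal_mul h.star_mul,
    modal_mul h.star_mul, modal_add]
  simp only [(h.coarsening ℓ hℓ).fKernel_add_interp_mul_rest]

/-- The three-level V-cycle on level `1` with zero initial guess. -/
theorem threeLevel_eq (h : DiagHierarchy m N Φ X lam) :
    Fmat m N Φ 1 + Pmat m N Φ 1 *
        (Fmat m N Φ 2 + Pmat m N Φ 2 * (Amat N Φ 3)⁻¹ * Rmat m N Φ 2) * Rmat m N Φ 1
      = modal X fun k => kerMat (N 1) (N 1)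
          (threeLevelKernel (m 1) (m 2) (lam 1 k) (lam 2 k) (lam 3 k)) := by
  rw [h.Amat_inv_eq (by omega), h.Fmat_add_Pmat_mul_Rmat (ℓ := 2) (by omega),
    h.Fmat_add_Pmat_mul_Rmat (ℓ := 1) (by omega)]
  rfl

theorem unitLower (h : DiagHierarchy m N Φ X lam) (k : Fin Nx) :
    UnitLower (threeLevelKernel (m 1) (m 2) (lam 1 k) (lam 2 k) (lam 3 k)) :=
  unitLower_threeLevelKernel (h.coarsening 1 (by omega)).pos (h.coarsening 2 (by omega)).pos

theorem coarseErrorPropagator_eq (h : DiagHierarchy m N Φ X lam) :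
    coarseErrorPropagator m N Φ = modal X fun k => kerMat (N 1) (N 1)
      (propKernel (m 0) (m 1) (m 2) (lam 0 k) (lam 1 k) (lam 2 k) (lam 3 k)) := by
  have e1 := h.RImat_mul_Pmat (ℓ := 0) (by omega)
  have e2 : ∀ {κ : Type} (Z : Matrix (Fin (N 1) × Fin Nx) κ ℂ),
      RImat Nx m N 0 * (Pmat m N Φ 0 * Z) = Z := by
    intro κ Z
    rw [← Matrix.mul_assoc]
    exact (congrArg (· * Z) e1).trans (Matrix.one_mul Z)
  have e3 : Rmat m N Φ 0 * (Amat N Φ 0 * Pmat m N Φ 0)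
      = modal X fun k => kerMat (N 1) (N 1) (sysKernel (lam 0 k ^ m 0)) := by
    rw [h.Amat_mul_Pmat (by omega), ← Matrix.mul_assoc,
      h.Rmat_mul_RImat_transpose (ℓ := 0) (by omega)]
    exact Matrix.one_mul _
  -- R_I P = 1 strips off level 0; the three subtracted terms are the expansion of the nested cycle
  -- operator.
  have e4 : coarseErrorPropagator m N Φ = 1 - (Fmat m N Φ 1 + Pmat m N Φ 1 *
        (Fmat m N Φ 2 + Pmat m N Φ 2 * (Amat N Φ 3)⁻¹ * Rmat m N Φ 2) * Rmat m N Φ 1)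
          * (Rmat m N Φ 0 * (Amat N Φ 0 * Pmat m N Φ 0)) := by
    rw [coarseErrorPropagator, errorPropagator]
    simp only [Matrix.mul_sub, Matrix.sub_mul, Matrix.mul_add, Matrix.add_mul, Matrix.mul_assoc,
      e1, e2, Matrix.mul_one]
    abel
  rw [e4, e3, h.threeLevel_eq, modal_mul h.star_mul, ← modal_one h.mul_star, modal_sub]
  congr 1
  funext k
  exact one_sub_mul_sysKernel _ (h.unitLower k) _

/-! ### Propagation of the residual -/

/-- Relaxation turns the residual into R_Iᵀ R b, and R R_Iᵀ = 1, so the coarse problem receives R b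
as if no relaxation had happened. -/
theorem vCycle_succ_zero (h : DiagHierarchy m N Φ X lam) {ℓ : ℕ} (hℓ : ℓ < 3) (c : ℕ)
    (b : STVec (N ℓ) Nx) :
    vCycle m N Φ (c + 1) ℓ b 0 = Fmat m N Φ ℓ *ᵥ b
      + Pmat m N Φ ℓ *ᵥ vCycle m N Φ c (ℓ + 1) (Rmat m N Φ ℓ *ᵥ b) 0 := by
  have e : Rmat m N Φ ℓ * (1 - Amat N Φ ℓ * Fmat m N Φ ℓ) = Rmat m N Φ ℓ := by
    rw [h.Amat_mul_Fmat hℓ, sub_sub_cancel, ← Matrix.mul_assoc, h.Rmat_mul_RImat_transpose hℓ,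
      Matrix.one_mul]
  have e' : Rmat m N Φ ℓ *ᵥ (b - Amat N Φ ℓ *ᵥ (Fmat m N Φ ℓ *ᵥ b)) = Rmat m N Φ ℓ *ᵥ b := by
    conv_rhs => rw [← e]
    rw [← Matrix.mulVec_mulVec, Matrix.sub_mulVec, Matrix.one_mulVec, Matrix.mulVec_mulVec]
  rw [vCycle, fRelax, Matrix.mulVec_zero, sub_zero, zero_add, e']

theorem vCycle_coarse (h : DiagHierarchy m N Φ X lam) (b : STVec (N 1) Nx) :
    vCycle m N Φ 2 1 b 0 = (modal X fun k => kerMat (N 1) (N 1)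
      (threeLevelKernel (m 1) (m 2) (lam 1 k) (lam 2 k) (lam 3 k))) *ᵥ b := by
  rw [← h.threeLevel_eq, h.vCycle_succ_zero (by omega), h.vCycle_succ_zero (by omega), vCycle]
  simp only [Matrix.add_mulVec, Matrix.mulVec_add, ← Matrix.mulVec_mulVec]

/-- Relaxation leaves the residual R_Iᵀ R r. The correction z = C_1 R r then removes A_0 P_0 z =
R_Iᵀ B z, so the cycle operator ends up to the right of B. -/
theorem residual_succ (h : DiagHierarchy m N Φ X lam) (g u₀ : STVec (N 0) Nx) (i : ℕ) :
    residual m N Φ g u₀ (i + 1) = (RImat Nx m N 0)ᵀ *ᵥ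
      ((modal X fun k => 1 - kerMat (N 1) (N 1) (sysKernel (lam 0 k ^ m 0)) *
        kerMat (N 1) (N 1) (threeLevelKernel (m 1) (m 2) (lam 1 k) (lam 2 k) (lam 3 k))) *ᵥ
          (Rmat m N Φ 0 *ᵥ residual m N Φ g u₀ i)) := by
  have hstep : iterate m N Φ g u₀ (i + 1) = vCycle m N Φ 3 0 g (iterate m N Φ g u₀ i) :=
    Function.iterate_succ_apply' _ _ _
  rw [residual, residual, hstep]
  generalize iterate m N Φ g u₀ i = x
  have e1 : g - Amat N Φ 0 *ᵥ fRelax m N Φ 0 g x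
      = (RImat Nx m N 0)ᵀ *ᵥ (Rmat m N Φ 0 *ᵥ (g - Amat N Φ 0 *ᵥ x)) := by
    rw [fRelax, Matrix.mulVec_add, Matrix.mulVec_mulVec, h.Amat_mul_Fmat (by omega),
      Matrix.sub_mulVec, Matrix.one_mulVec, Matrix.mulVec_mulVec]
    abel
  have e2 : Rmat m N Φ 0 *ᵥ (g - Amat N Φ 0 *ᵥ fRelax m N Φ 0 g x)
      = Rmat m N Φ 0 *ᵥ (g - Amat N Φ 0 *ᵥ x) := by
    rw [e1, Matrix.mulVec_mulVec, h.Rmat_mul_RImat_transpose (ℓ := 0) (by omega)]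
    exact Matrix.one_mulVec _
  rw [vCycle, e2, h.vCycle_coarse, Matrix.mulVec_add, ← sub_sub, e1,
    Matrix.mulVec_mulVec _ (Amat N Φ 0), h.Amat_mul_Pmat (by omega), ← modal_sub (fun _ => 1), modal_one h.mul_star,
    Matrix.sub_mulVec, Matrix.one_mulVec, Matrix.mulVec_sub (RImat Nx m N 0)ᵀ, ← modal_mul h.star_mul,
    ← Matrix.mulVec_mulVec, ← Matrix.mulVec_mulVec]

/-- From the second iteration on, or after initial F-relaxation, the residual lives on the
C-points. -/
theorem exists_residual_eq (h : DiagHierarchy m N Φ X lam) {g u₀ : STVec (N 0) Nx} {i : ℕ}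
    (hi : 1 ≤ i ∨ FRelaxedStart m N Φ g u₀) :
    ∃ w : STVec (N 1) Nx, residual m N Φ g u₀ i = (RImat Nx m N 0)ᵀ *ᵥ w := by
  rcases i with _ | i
  · have hF : FRelaxedStart m N Φ g u₀ := hi.resolve_left (by omega)
    have hC := h.coarsening 0 (by omega)
    have hlt : ∀ c : Fin (N 1), (c : ℕ) * m 0 < N 0 := fun c => by
      rw [mul_comm]; exact hC.mul_lt c
    -- The witness consists of the values at the C-points.
    refine ⟨fun c => residual m N Φ g u₀ 0 (⟨c.1 * m 0, hlt c.1⟩, c.2), ?_⟩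
    funext p
    rw [Matrix.mulVec, dotProduct]
    simp only [Matrix.transpose_apply, RImat, injection, Matrix.of_apply]
    by_cases hp : m 0 ∣ (p.1 : ℕ)
    · obtain ⟨c, hc⟩ := hp
      have hm := hC.pos
      have hcN : c < N 1 := by
        have := hC.div_lt p.1
        rwa [hc, Nat.mul_div_cancel_left _ hm] at this
      rw [Finset.sum_eq_single_of_mem (⟨c, hcN⟩, p.2) (Finset.mem_univ _)]
      · have hp1 : p.1 = ⟨c * m 0, hlt ⟨c, hcN⟩⟩ := Fin.ext (by rw [hc, mul_comm])
        rw [if_pos (by rw [hc, mul_comm]), Matrix.one_apply_eq, one_mul, ← hp1]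
      · rintro ⟨c', a⟩ - hne
        split_ifs with h1
        · have h2 : (c' : ℕ) = c := by
            rw [hc, mul_comm] at h1
            exact (Nat.eq_of_mul_eq_mul_right hm h1).symm
          rw [Matrix.one_apply_ne, zero_mul]
          rintro rfl
          exact hne (Prod.ext (Fin.ext h2) rfl)
        · rw [zero_mul]
    · rw [Finset.sum_eq_zero]
      · exact hF ⟨p.1, hp⟩ p.2
      · rintro ⟨c, a⟩ -
        rw [if_neg, zero_mul]
        exact fun h1 => hp (Dvd.intro_left _ h1.symm)
  · exact ⟨_, h.residual_succ g u₀ i⟩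

end DiagHierarchy

/-! ### Norms of the level-1 propagator and the bound on the convergence factor -/

theorem absColSum_le_matNorm1 {ι κ : Type*} [Fintype ι] [Finite κ] (M : Matrix ι κ ℂ) (q : κ) :
    absColSum M q ≤ matNorm1 M :=
  le_ciSup (Set.finite_range _).bddAbove q

theorem absRowSum_le_matNormInf {ι κ : Type*} [Fintype κ] [Finite ι] (M : Matrix ι κ ℂ) (p : ι) :
    absRowSum M p ≤ matNormInf M :=
  le_ciSup (f := absRowSum M) (Set.finite_range _).bddAbove p

theorem matNorm1_nonneg {ι κ : Type*} [Fintype ι] (M : Matrix ι κ ℂ) : 0 ≤ matNorm1 M :=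
  Real.iSup_nonneg fun _ => Finset.sum_nonneg fun _ _ => norm_nonneg _

namespace DiagHierarchy

variable {Nx : ℕ} {m N : ℕ → ℕ} {Φ : ℕ → SpaceOp Nx} {X : SpaceOp Nx} {lam : ℕ → Fin Nx → ℂ}

/-- The hierarchy of a single set of eigenvalues, written in the eigenbasis. -/
theorem diagonal (h : DiagHierarchy m N Φ X lam) :
    DiagHierarchy m N (fun ℓ => Matrix.diagonal (lam ℓ)) 1 lam where
  star_mul := by simp
  mul_star := by simp
  coarsening := h.coarsening
  eq_conj ℓ _ := by simp

theorem diagonalizedPropagator_eq (h : DiagHierarchy m N Φ X lam) :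
    diagonalizedPropagator m N lam = modal 1 fun k => kerMat (N 1) (N 1)
      (propKernel (m 0) (m 1) (m 2) (lam 0 k) (lam 1 k) (lam 2 k) (lam 3 k)) :=
  h.diagonal.coarseErrorPropagator_eq

theorem absColSum_eq (h : DiagHierarchy m N Φ X lam) (q : Fin (N 1)) (k : Fin Nx) :
    absColSum (diagonalizedPropagator m N lam) (q, k) = ∑ p ∈ Finset.range (N 1),
      ‖propKernel (m 0) (m 1) (m 2) (lam 0 k) (lam 1 k) (lam 2 k) (lam 3 k) p q‖ := by
  rw [h.diagonalizedPropagator_eq, absColSum_modal_one]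
  exact Fin.sum_univ_eq_sum_range (fun p =>
    ‖propKernel (m 0) (m 1) (m 2) (lam 0 k) (lam 1 k) (lam 2 k) (lam 3 k) p q‖) _

theorem absRowSum_eq (h : DiagHierarchy m N Φ X lam) (p : Fin (N 1)) (k : Fin Nx) :
    absRowSum (diagonalizedPropagator m N lam) (p, k) = ∑ q ∈ Finset.range (N 1),
      ‖propKernel (m 0) (m 1) (m 2) (lam 0 k) (lam 1 k) (lam 2 k) (lam 3 k) p q‖ := by
  rw [h.diagonalizedPropagator_eq, absRowSum_modal_one]
  exact Fin.sum_univ_eq_sum_range (fun q =>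
    ‖propKernel (m 0) (m 1) (m 2) (lam 0 k) (lam 1 k) (lam 2 k) (lam 3 k) p q‖) _

theorem coarse_card (h : DiagHierarchy m N Φ X lam) :
    N 1 = m 1 * (m 2 * (N 3 - 1)) + 1 := by
  have h1 := (h.coarsening 1 (by omega)).fine_eq
  have h2 := (h.coarsening 2 (by omega)).fine_eq
  simp only [Nat.reduceAdd] at h1 h2
  rw [h1, h2, Nat.add_sub_cancel]

theorem absColSum_eq_sCol (h : DiagHierarchy m N Φ X lam) (hN3 : 2 ≤ N 3)
    (hlam : ∀ ℓ < 4, ∀ k, ‖lam ℓ k‖ < 1) (k : Fin Nx) (p : Fin (N 1))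
    (hp : (p : ℕ) < m 1 * m 2) :
    absColSum (diagonalizedPropagator m N lam) (p, k)
      = sCol (m 0) (m 1) (m 2) (N 3) (lam 0 k) (lam 1 k) (lam 2 k) (lam 3 k) p := by
  rw [h.absColSum_eq, congrArg Finset.range h.coarse_card, Finset.sum_range_succ,
    ← colWeight_propKernel (h.coarsening 1 (by omega)).pos (h.coarsening 2 (by omega)).pos hN3
      (hlam 1 (by omega) k) (hlam 2 (by omega) k) (hlam 3 (by omega) k) hp, colWeight, one_mul]

theorem absRowSum_eq_sRow (h : DiagHierarchy m N Φ X lam) (hN3 : 2 ≤ N 3)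
    (hlam : ∀ ℓ < 4, ∀ k, ‖lam ℓ k‖ < 1) (k : Fin Nx) (p : Fin (N 1)) (t : ℕ) (ht : 1 ≤ t)
    (hp : (p : ℕ) + 1 + m 1 * m 2 = N 1 + t) :
    absRowSum (diagonalizedPropagator m N lam) (p, k)
      = sRow (m 0) (m 1) (m 2) (N 3) (lam 0 k) (lam 1 k) (lam 2 k) (lam 3 k) t := by
  have hcard := h.coarse_card
  have hM : m 1 * (m 2 * (N 3 - 1)) = m 1 * (m 2 * (N 3 - 2)) + m 1 * m 2 := by
    rw [show N 3 - 1 = N 3 - 2 + 1 by omega]; ring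
  -- The last column, which `rowSum` does not count, is zero by strict triangularity.
  rw [← rowSum_propKernel (h.coarsening 1 (by omega)).pos (h.coarsening 2 (by omega)).pos hN3
      (hlam 1 (by omega) k) (hlam 2 (by omega) k) (hlam 3 (by omega) k) ht (by omega),
    h.absRowSum_eq, congrArg Finset.range hcard, Finset.sum_range_succ, propKernel_of_le (by omega), norm_zero, add_zero,
    rowSum, show (p : ℕ) = m 1 * (m 2 * (N 3 - 2)) + t by omega]

theorem matNorm1_eq (h : DiagHierarchy m N Φ X lam) (hN3 : 2 ≤ N 3) (hNx : 1 ≤ Nx)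
    (hlam : ∀ ℓ < 4, ∀ k, ‖lam ℓ k‖ < 1) :
    matNorm1 (diagonalizedPropagator m N lam) = ⨆ (s : Fin Nx × Fin (m 1 * m 2)),
      sCol (m 0) (m 1) (m 2) (N 3) (lam 0 s.1) (lam 1 s.1) (lam 2 s.1) (lam 3 s.1) s.2 := by
  have hm1 := (h.coarsening 1 (by omega)).pos
  have hm2 := (h.coarsening 2 (by omega)).pos
  have hM : 1 ≤ m 1 * m 2 := Nat.mul_pos hm1 hm2
  have hcard : N 1 = m 1 * m 2 * (N 3 - 1) + 1 := by rw [h.coarse_card, mul_assoc]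
  have hMN : m 1 * m 2 ≤ m 1 * m 2 * (N 3 - 1) := Nat.le_mul_of_pos_right _ (by omega)
  have : Nonempty (Fin Nx) := ⟨⟨0, hNx⟩⟩
  have : Nonempty (Fin (m 1 * m 2)) := ⟨⟨0, hM⟩⟩
  have : Nonempty (Fin (N 1)) := ⟨⟨0, by omega⟩⟩
  apply le_antisymm
  · refine ciSup_le ?_
    rintro ⟨q, k⟩
    have hd : (q : ℕ) % (m 1 * m 2) < m 1 * m 2 := Nat.mod_lt _ hM
    -- The column in the first interval from which `q` arises by shifts.
    let q' : Fin (N 1) := ⟨q % (m 1 * m 2), by omega⟩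
    refine le_trans ?_ (le_ciSup (Set.finite_range _).bddAbove (k, ⟨q % (m 1 * m 2), hd⟩))
    rw [← h.absColSum_eq_sCol hN3 hlam k q' hd, h.absColSum_eq, h.absColSum_eq]
    have hq : (q : ℕ) = q' + m 1 * m 2 * (q / (m 1 * m 2)) := (Nat.mod_add_div _ _).symm
    rw [hq]
    exact sum_col_shift_le (fun _ _ => propKernel_of_le) (propKernel_shift hm1 hm2) _ _
  · refine ciSup_le ?_
    rintro ⟨k, d⟩
    have hd : (d : ℕ) < N 1 := by omega
    rw [← h.absColSum_eq_sCol hN3 hlam k ⟨d, hd⟩ d.2]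
    exact absColSum_le_matNorm1 _ _

theorem matNormInf_eq (h : DiagHierarchy m N Φ X lam) (hN3 : 2 ≤ N 3) (hNx : 1 ≤ Nx)
    (hlam : ∀ ℓ < 4, ∀ k, ‖lam ℓ k‖ < 1) :
    matNormInf (diagonalizedPropagator m N lam) = ⨆ (s : Fin Nx × Fin (m 1 * m 2)),
      sRow (m 0) (m 1) (m 2) (N 3) (lam 0 s.1) (lam 1 s.1) (lam 2 s.1) (lam 3 s.1) (s.2 + 1) := by
  have hm1 := (h.coarsening 1 (by omega)).pos
  have hm2 := (h.coarsening 2 (by omega)).pos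
  have hM : 1 ≤ m 1 * m 2 := Nat.mul_pos hm1 hm2
  have hcard : N 1 = m 1 * m 2 * (N 3 - 2) + m 1 * m 2 + 1 := by
    rw [h.coarse_card, show N 3 - 1 = N 3 - 2 + 1 by omega]; ring
  have : Nonempty (Fin Nx) := ⟨⟨0, hNx⟩⟩
  have : Nonempty (Fin (m 1 * m 2)) := ⟨⟨0, hM⟩⟩
  have : Nonempty (Fin (N 1)) := ⟨⟨0, by omega⟩⟩
  apply le_antisymm
  · refine ciSup_le ?_
    rintro ⟨p, k⟩
    -- Shift `p` down into the last interval, which excludes its left end and includes its right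
    -- one: multiples of `m 1 * m 2` go to the final row, `d = m 1 * m 2 - 1`.
    obtain ⟨s, d, hd, hs⟩ : ∃ s d, d < m 1 * m 2 ∧
        (p : ℕ) + m 1 * m 2 * s = m 1 * m 2 * (N 3 - 2) + (d + 1) := by
      obtain ⟨P, i, hi, hp⟩ := exists_mul_add hM p
      have hP : P ≤ N 3 - 2 + 1 := by
        by_contra hc
        have := Nat.mul_le_mul_left (m 1 * m 2) (Nat.succ_le_of_lt (not_le.1 hc))
        rw [Nat.mul_succ, Nat.mul_succ] at this
        omega
      rcases i with _ | i
      · refine ⟨N 3 - 2 + 1 - P, m 1 * m 2 - 1, by omega, ?_⟩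
        rw [hp, add_zero, ← Nat.mul_add, Nat.add_sub_cancel' hP, Nat.mul_succ]
        omega
      · have hP : P ≤ N 3 - 2 := by
          by_contra hc
          have := Nat.mul_le_mul_left (m 1 * m 2) (Nat.succ_le_of_lt (not_le.1 hc))
          rw [Nat.mul_succ] at this
          omega
        refine ⟨N 3 - 2 - P, i, by omega, ?_⟩
        rw [hp, add_right_comm, ← Nat.mul_add, Nat.add_sub_cancel' hP]
    let p' : Fin (N 1) := ⟨p + m 1 * m 2 * s, by omega⟩
    have hp' : (p' : ℕ) = p + m 1 * m 2 * s := rfl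
    refine le_trans ?_ (le_ciSup (Set.finite_range _).bddAbove (k, ⟨d, hd⟩))
    rw [← h.absRowSum_eq_sRow hN3 hlam k p' (d + 1) (by omega) (by omega), h.absRowSum_eq,
      h.absRowSum_eq]
    exact sum_row_le_shift (fun _ _ => propKernel_of_le) (propKernel_shift hm1 hm2) p'.2
  · refine ciSup_le ?_
    rintro ⟨k, d⟩
    let p : Fin (N 1) := ⟨m 1 * m 2 * (N 3 - 2) + (d + 1), by omega⟩
    have hp : (p : ℕ) = m 1 * m 2 * (N 3 - 2) + (d + 1) := rfl
    rw [← h.absRowSum_eq_sRow hN3 hlam k p (d + 1) (by omega) (by omega)]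
    exact absRowSum_le_matNormInf _ _

theorem convergenceFactor_le (h : DiagHierarchy m N Φ X lam) :
    convergenceFactor m N Φ ≤ ENNReal.ofReal (√(matNorm1 (diagonalizedPropagator m N lam) *
      matNormInf (diagonalizedPropagator m N lam))) := by
  have hC := h.coarsening 0 (by omega)
  have hrev : ∀ k (p q : Fin (N 1)),
      (1 - kerMat (N 1) (N 1) (sysKernel (lam 0 k ^ m 0)) *
        kerMat (N 1) (N 1) (threeLevelKernel (m 1) (m 2) (lam 1 k) (lam 2 k) (lam 3 k)))
          q.rev p.rev
      = kerMat (N 1) (N 1)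
          (propKernel (m 0) (m 1) (m 2) (lam 0 k) (lam 1 k) (lam 2 k) (lam 3 k)) p q := by
    intro k p q
    rw [propKernel, ← one_sub_mul_sysKernel _ (h.unitLower k)]
    refine one_sub_sysKernel_mul_rev (fun p q => ?_) _ p q
    have hcard := h.coarse_card
    have hsub : ∀ p : Fin (N 1), (p.rev : ℕ) = m 1 * (m 2 * (N 3 - 1)) - p := fun p => by
      rw [Fin.val_rev]; omega
    rw [hsub, hsub]
    exact threeLevelKernel_rev (h.coarsening 1 (by omega)).pos (h.coarsening 2 (by omega)).pos
      (by omega) (by omega)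
  refine iSup_le fun g => iSup_le fun u₀ => iSup_le fun i => iSup_le fun hi => ?_
  -- The product form also covers a vanishing residual, since it forces the next one to vanish.
  refine ENNReal.div_le_of_le_mul ?_
  rw [← ENNReal.ofReal_mul (Real.sqrt_nonneg _)]
  refine ENNReal.ofReal_le_ofReal ?_
  obtain ⟨w, hw⟩ := h.exists_residual_eq hi
  have hRw : Rmat m N Φ 0 *ᵥ ((RImat Nx m N 0)ᵀ *ᵥ w) = w := by
    rw [Matrix.mulVec_mulVec, h.Rmat_mul_RImat_transpose (ℓ := 0) (by omega)]
    exact Matrix.one_mulVec _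
  rw [h.residual_succ, hw, hRw, RImat, norm2_injection_transpose_mulVec hC,
    norm2_injection_transpose_mulVec hC, mul_comm (matNorm1 _)]
  -- By `hrev`, rows of this matrix are reversed columns of the error propagator and vice versa, so
  -- the two norms exchange roles.
  refine norm2_modal_mulVec_le h.star_mul h.mul_star _ (matNorm1_nonneg _) ?_ ?_ w
  · intro k p
    refine le_trans (le_of_eq ?_) (absColSum_le_matNorm1 _ (p.rev, k))
    rw [h.diagonalizedPropagator_eq, absColSum_modal_one, ← Equiv.sum_comp Fin.revPerm]
    refine Finset.sum_congr rfl fun q _ => ?_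
    rw [← hrev k q p.rev, Fin.rev_rev, Fin.revPerm_apply]
  · intro k q
    refine le_trans (le_of_eq ?_) (absRowSum_le_matNormInf _ (q.rev, k))
    rw [h.diagonalizedPropagator_eq, absRowSum_modal_one, ← Equiv.sum_comp Fin.revPerm]
    refine Finset.sum_congr rfl fun p _ => ?_
    rw [← hrev k q.rev p, Fin.rev_rev, Fin.revPerm_apply]

end DiagHierarchy

end MGRIT

end

theorem mainTheorem5 (Nx : ℕ) (hNx : 1 ≤ Nx) (m N : ℕ → ℕ)
    (hm : ∀ ℓ < 3, 1 ≤ m ℓ)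
    (hN : ∀ ℓ < 3, N ℓ = m ℓ * (N (ℓ + 1) - 1) + 1)
    (hN3 : 2 ≤ N 3)
    (Φ : ℕ → Matrix (Fin Nx) (Fin Nx) ℂ)
    (X : Matrix (Fin Nx) (Fin Nx) ℂ) (hX : X ∈ Matrix.unitaryGroup (Fin Nx) ℂ)
    (lam : ℕ → Fin Nx → ℂ)
    (hΦ : ∀ ℓ < 4, Φ ℓ = X * Matrix.diagonal (lam ℓ) * Xᴴ)
    (hlam : ∀ ℓ < 4, ∀ k, ‖lam ℓ k‖ < 1) :
    -- the bound on the worst-case convergence factor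
    MGRIT.convergenceFactor m N Φ ≤
      ENNReal.ofReal (√(MGRIT.matNorm1 (MGRIT.diagonalizedPropagator m N lam) *
        MGRIT.matNormInf (MGRIT.diagonalizedPropagator m N lam))) ∧
    -- the two norms
    MGRIT.matNorm1 (MGRIT.diagonalizedPropagator m N lam) =
      (⨆ (s : Fin Nx × Fin (m 1 * m 2)),
        MGRIT.sCol (m 0) (m 1) (m 2) (N 3)
          (lam 0 s.1) (lam 1 s.1) (lam 2 s.1) (lam 3 s.1) s.2) ∧
    MGRIT.matNormInf (MGRIT.diagonalizedPropagator m N lam) =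
      (⨆ (s : Fin Nx × Fin (m 1 * m 2)),
        MGRIT.sRow (m 0) (m 1) (m 2) (N 3)
          (lam 0 s.1) (lam 1 s.1) (lam 2 s.1) (lam 3 s.1) (s.2 + 1)) ∧
    -- the absolute column sums of the first CF-interval on level 1
    (∀ (k : Fin Nx) (p : Fin (N 1)), (p : ℕ) < m 1 * m 2 →
      MGRIT.absColSum (MGRIT.diagonalizedPropagator m N lam) (p, k) =
        MGRIT.sCol (m 0) (m 1) (m 2) (N 3) (lam 0 k) (lam 1 k) (lam 2 k) (lam 3 k) p) ∧
    -- the absolute row sums of the last FC-interval on level 1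
    (∀ (k : Fin Nx) (p : Fin (N 1)) (t : ℕ), 1 ≤ t → (p : ℕ) + 1 + m 1 * m 2 = N 1 + t →
      MGRIT.absRowSum (MGRIT.diagonalizedPropagator m N lam) (p, k) =
        MGRIT.sRow (m 0) (m 1) (m 2) (N 3) (lam 0 k) (lam 1 k) (lam 2 k) (lam 3 k) t) := by
  -- The coarsest size is positive by `hN3`, the others because they have the form m(⋯) + 1.
  have hpos : ∀ ℓ ≤ 3, 1 ≤ N (3 - ℓ) := by
    intro ℓ hℓ
    rcases ℓ with _ | ℓ
    · show 1 ≤ N 3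
      omega
    · rw [hN _ (by omega)]
      omega
  have h : MGRIT.DiagHierarchy m N Φ X lam :=
    { star_mul := Matrix.mem_unitaryGroup_iff'.1 hX
      mul_star := Matrix.mem_unitaryGroup_iff.1 hX
      coarsening := fun ℓ hℓ =>
        { pos := hm ℓ hℓ
          coarse_pos := by
            have := hpos (2 - ℓ) (by omega)
            rwa [show 3 - (2 - ℓ) = ℓ + 1 by omega] at this
          fine_eq := hN ℓ hℓ }
      eq_conj := hΦ }
  exact ⟨h.convergenceFactor_le, h.matNorm1_eq hN3 hNx hlam, h.matNormInf_eq hN3 hNx hlam,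
    h.absColSum_eq_sCol hN3 hlam, h.absRowSum_eq_sRow hN3 hlam⟩
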